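/- **Conventions.** Let $2\le d\le\omega$, identified with $\{n\in\omega : n<d\}$; $d$ is discrete and $d^\omega$, $(d^\omega)^d$, $2^\omega$ carry product topologies. $\Sigma^0_1$ sets are the open sets; for $\xi>1$, $\Sigma^0_\xi$ sets are the countable unions of complements of sets of classes $\Sigma^0_\eta$ with $1\le\eta<\xi$; $\Pi^0_\xi$ sets are the complements of $\Sigma^0_\xi$ sets and $\Delta^0_\xi=\Sigma^0_\xi\cap\Pi^0_\xi$. For a class $\Gamma$, a Borel set $B\subseteq\prod_{i\in d}X_i$ (with $X_i$ Polish) is $\mathrm{pot}(\Gamma)$ if there are finer zero-dimensional Polish topologies $\tau_i$ on the $X_i$ with $B\in\Gamma(\prod_i(X_i,\tau_i))$. A set $A$ is separable from $B$ by a $\mathrm{pot}(\Gamma)$ set if there is $P\in\mathrm{pot}(\Gamma)$ with $A\subseteq P$ and $P\cap B=\emptyset$. A tree $T$ on $d^d$ (a set of finite sequences of elements of $d^d$, closed under initial segments) has *$\Delta^1_1$ suitable levels* if for each $l\in\omega$ its level $\mathcal T^l=T\cap(d^d)^l$, seen as a subset of $(d^l)^d$, is - finite; - one-sided: distinct elements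 $\vec x,\vec y$ have at most one common coordinate $x_i=y_i$; - almost acyclic: for the graph on $\mathcal T^l$ relating distinct elements with a common coordinate, every cycle $(\vec x^n)_{n\le L}$ has $i\in d$ and $k<m<n<L$ with $x^k_i=x^m_i=x^n_i$; - (lightface) $\Delta^1_1$, as a subset of $(d^d)^l\subseteq(\omega^\omega)^l$ (if $d<\omega$, elements of $d^d$ are extended by $0$). $[T]$ is the set of $\vec\alpha\in(d^\omega)^d$ with $\big((\alpha_i(j))_{i\in d}\big)_{j<n}\in T$ for every $n$. **The tree.** Let $\langle n,p\rangle=\big(\sum_{k\le n+p}k\big)+p$, a bijection $\omega^2\to\omega$, with inverse $l\mapsto((l)_0,(l)_1)$. Let $b_d:\omega\to d^{<\omega}$ be the following bijective enumeration: by length and then lexicographically if $d<\omega$; by increasing $\prod_{j<|s|}p_j^{s(j)+1}$ if $d=\omega$, where $p_j$ is the $j$-th prime. For $i\in d$ put $s^i_0=\emptyset$ and, for $l=\langle p,\langle r,\langle q,n\rangle\rangle\rangle$ and $t=b_d(n)$, $s^i_{l+1}=s^i_q\; i\; t\; 0^{\,l-q-|t|}$. Let $T_d$ consist of the empty sequence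 and of the sequences $\vec s$ such that for some $l\in\omega$ and $t\in d^{<\omega}$, $s_i=s^i_l\,i\,t$ for all $i\in d$, and $s_0(n)\le n$ for all $n<|s_0|$. **The sets $C_\xi$.** Let $\mathcal S(\alpha)(m)=\alpha(m+1)$ be the shift map on $2^\omega$, and for $\alpha,\beta\in d^\omega$ let $(\alpha\Delta\beta)(m)=1$ iff $\alpha(m)\ne\beta(m)$. Let $\rho_0:2^\omega\to2^\omega$ be given by $\rho_0(\alpha)(m)=1$ iff $\alpha(\langle m,n\rangle)=0$ for all $n$. For each limit $0<\eta<\omega_1$ fix, arbitrarily, successor ordinals $\theta^\eta_m<\eta$ $(m\in\omega)$ with $\sum_m\theta^\eta_m=\eta$. Put $\rho_0^0=\mathrm{Id}$, $\rho_0^{\eta+1}=\rho_0\circ\rho_0^\eta$ and, for $\eta$ limit, $\rho_0^\eta(\alpha)(m)=\big(\rho_0^{(m,m+1)}\circ\cdots\circ\rho_0^{(0,1)}\big)(\alpha)(m)$, where $\rho_0^{(m,m+1)}(\alpha)(i)$ is $\alpha(i)$ if $i<m$ and $\rho_0^{\theta^\eta_m}(\mathcal S^m(\alpha))(i-m)$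 if $i\ge m$. For $1\le\xi=1+\eta<\omega_1$ and $\varepsilon\in\{0,1\}$ let $$C_\xi=\{\alpha\in2^\omega:\rho_0^\eta(\alpha)\ne0^\infty\},$$ $$C^\varepsilon_\xi=\{\alpha\in2^\omega:\exists m\ \rho_0^\eta(\alpha)(m)=1\wedge\forall l<m\ \rho_0^\eta(\alpha)(l)=0\wedge(m)_0\equiv\varepsilon\ (\mathrm{mod}\ 2)\},$$ and, with $S^d_C=\{\vec\alpha\in[T_d]:\mathcal S(\alpha_0\Delta\alpha_1)\in C\}$, let $\mathbb S^d_\xi=S^d_{C_\xi}$ and $\mathbb S^\varepsilon_\xi=S^d_{C^\varepsilon_\xi}$. **Theorem 3.1.** For every $2\le d\le\omega$, $T_d$ is a tree on $d^d$ with $\Delta^1_1$ suitable levels, and for every choice of the sequences $(\theta^\eta_m)_m$ and every $1\le\xi<\omega_1$: (1) $\mathbb S^d_\xi\in\Sigma^0_\xi([T_d])$, and $\mathbb S^d_\xi$ is not separable from $[T_d]\setminus\mathbb S^d_\xi$ by a $\mathrm{pot}(\Pi^0_\xi)$ set; (2) $\mathbb S^0_\xi,\mathbb S^1_\xi\in\Sigma^0_\xi([T_d])$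 are disjoint, and $\mathbb S^0_\xi$ is not separable from $\mathbb S^1_\xi$ by a $\mathrm{pot}(\Delta^0_\xi)$ set. -/

import Mathlib

open scoped Ordinal

noncomputable section

namespace PotWadge

/-! ### Borel classes, potential classes, separation -/

/-- `SigmaZero ξ A`: the subset `A` of the (metrizable) space `X` is in the additive Borel class
`Σ⁰_ξ`.  `Σ⁰_1` is the class of open sets, and for `ξ > 1` the class `Σ⁰_ξ` consists of the countable
unions of complements of sets of classes `Σ⁰_η`, `1 ≤ η < ξ`.  No set is in `Σ⁰_0`. -/
inductive SigmaZero {X : Type} [TopologicalSpace X] : Ordinal.{0} → Set X → Prop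
  | of_isOpen (U : Set X) : IsOpen U → SigmaZero 1 U
  | iUnion_compl (ξ : Ordinal.{0}) (η : ℕ → Ordinal.{0}) (A : ℕ → Set X) :
      1 < ξ → (∀ n, 1 ≤ η n) → (∀ n, η n < ξ) → (∀ n, SigmaZero (η n) (A n)) →
      SigmaZero ξ (⋃ n, (A n)ᶜ)

/-- The multiplicative class `Π⁰_ξ`. -/
def PiZero {X : Type} [TopologicalSpace X] (ξ : Ordinal.{0}) (A : Set X) : Prop :=
  SigmaZero ξ Aᶜ

/-- The ambiguous class `Δ⁰_ξ`. -/
def DeltaZero {X : Type} [TopologicalSpace X] (ξ : Ordinal.{0}) (A : Set X) : Prop :=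
  SigmaZero ξ A ∧ PiZero ξ A

/-- `A`, a subset of a topological space `Y`, is in `Γ(Y)` for the class `Γ`. -/
abbrev PointClass := (Y : Type) → TopologicalSpace Y → Set Y → Prop

/-- The class `Π⁰_ξ`, as a class of subsets of arbitrary spaces. -/
def piClass (ξ : Ordinal.{0}) : PointClass := fun _ _ A => PiZero ξ A

/-- The class `Δ⁰_ξ`, as a class of subsets of arbitrary spaces. -/
def deltaClass (ξ : Ordinal.{0}) : PointClass := fun _ _ A => DeltaZero ξ A

/-- `t'` is a zero-dimensional Polish topology on `X` that is finer than `t`. -/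
def IsFinerZeroDimPolish {X : Type} (t t' : TopologicalSpace X) : Prop :=
  t' ≤ t ∧ @PolishSpace X t' ∧ @TopologicalSpace.IsTopologicalBasis X t' {U | @IsClopen X t' U}

/-- `B ⊆ ∏ i, X i` is potentially in `Γ`: it is Borel, and there are finer zero-dimensional Polish
topologies `τ i` on the factors such that `B` is in `Γ` for the product of the `τ i`. -/
def IsPot {ι : Type} {X : ι → Type} [t : ∀ i, TopologicalSpace (X i)] (Γ : PointClass)
    (B : Set (∀ i, X i)) : Prop :=
  @MeasurableSet (∀ i, X i) (borel (∀ i, X i)) B ∧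
    ∃ τ : ∀ i, TopologicalSpace (X i), (∀ i, IsFinerZeroDimPolish (t i) (τ i)) ∧
      Γ (∀ i, X i) (@Pi.topologicalSpace ι X τ) B

/-- `A` is separable from `B` by a `pot(Γ)` set. -/
def PotSeparable {ι : Type} {X : ι → Type} [∀ i, TopologicalSpace (X i)] (Γ : PointClass)
    (A B : Set (∀ i, X i)) : Prop :=
  ∃ P : Set (∀ i, X i), IsPot Γ P ∧ A ⊆ P ∧ Disjoint P B

/-- `S` is a subset of `F` which is `Σ⁰_ξ` in the subspace `F`. -/
def IsSigmaZeroIn {X : Type} [TopologicalSpace X] (ξ : Ordinal.{0}) (F S : Set X) : Prop :=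
  S ⊆ F ∧ SigmaZero ξ ((Subtype.val : F → X) ⁻¹' S)

/-! ### Trees with suitable levels -/

/-- The graph `G^𝒯` on `𝒯 ⊆ X^I`: distinct elements are related if they share a coordinate. -/
def coordGraph {I X : Type} (𝒯 : Set (I → X)) : SimpleGraph 𝒯 where
  Adj x y := x ≠ y ∧ ∃ i, x.1 i = y.1 i
  symm := ⟨fun _ _ h => ⟨h.1.symm, h.2.imp fun _ hi => hi.symm⟩⟩
  loopless := ⟨fun _ h => h.1 rfl⟩

/-- Distinct elements of `𝒯` share at most one coordinate. -/
def OneSided {I X : Type} (𝒯 : Set (I → X)) : Prop :=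
  ∀ x ∈ 𝒯, ∀ y ∈ 𝒯, x ≠ y → ∀ i j, i ≠ j → x i ≠ y i ∨ x j ≠ y j

/-- Every cycle `(x^n)_{n ≤ L}` of `G^𝒯` has three vertices `x^k, x^m, x^n`, `k < m < n < L`, with a
common `i`-th coordinate for some `i`. -/
def AlmostAcyclic {I X : Type} (𝒯 : Set (I → X)) : Prop :=
  ∀ (v : 𝒯) (w : (coordGraph 𝒯).Walk v v), w.IsCycle →
    ∃ (i : I) (k m n : ℕ), k < m ∧ m < n ∧ n < w.length ∧
      (w.getVert k).1 i = (w.getVert m).1 i ∧ (w.getVert m).1 i = (w.getVert n).1 i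

/-- The `l`-th level of a set `T` of finite sequences of elements of `A^I`, seen as a subset of
`(A^l)^I` (a finite sequence of functions is identified with a function into sequences). -/
def level {I A : Type} (T : Set (List (I → A))) (l : ℕ) : Set (I → List A) :=
  {x | ∃ s ∈ T, s.length = l ∧ x = fun i => s.map fun v => v i}

/-- The set of infinite branches of `T`, seen as a subset of `(A^ω)^I`. -/
def body {I A : Type} (T : Set (List (I → A))) : Set (I → ℕ → A) :=
  {α | ∀ n : ℕ, ((List.range n).map fun j i => α i j) ∈ T}

/-- Lightface `Σ¹_1` subsets of `(ω^ω)^l`: projections along `ω^ω` of the sets of branches of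
recursive trees (normal form), i.e. `x ∈ A ↔ ∃ y ∈ ω^ω, ∀ n, R (x|n, y|n)` with `R` recursive. -/
def IsSigmaOneOne {l : ℕ} (A : Set (Fin l → ℕ → ℕ)) : Prop :=
  ∃ R : List (List ℕ) × List ℕ → Prop, ComputablePred R ∧
    ∀ x, x ∈ A ↔ ∃ y : ℕ → ℕ, ∀ n : ℕ,
      R (List.ofFn fun j => (List.range n).map (x j), (List.range n).map y)

/-- Lightface `Δ¹_1` subsets of `(ω^ω)^l`. -/
def IsDeltaOneOne {l : ℕ} (A : Set (Fin l → ℕ → ℕ)) : Prop :=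
  IsSigmaOneOne A ∧ IsSigmaOneOne Aᶜ

/-- The cardinal `d ≤ ω`, as the set of integers smaller than `d`. -/
abbrev Dig (d : ℕ∞) : Type := {n : ℕ // (n : ℕ∞) < d}

/-- The `l`-th level of `T`, as a subset of `(ω^ω)^l`: an element `v` of `d^d` is identified with the
element of `ω^ω` that extends it by the value `0` (when `d = ω`, this is `v` itself). -/
def levelCode {d : ℕ∞} (T : Set (List (Dig d → Dig d))) (l : ℕ) : Set (Fin l → ℕ → ℕ) :=
  {x | ∃ s ∈ T, ∃ hs : s.length = l, ∀ (j : Fin l) (i : ℕ),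
    x j i = if hi : (i : ℕ∞) < d then ((s[j.1]'(hs ▸ j.2)) ⟨i, hi⟩ : ℕ) else 0}

/-- `T` is a tree on `d^d` with `Δ¹_1` suitable levels. -/
def IsTreeWithDeltaSuitableLevels {d : ℕ∞} (T : Set (List (Dig d → Dig d))) : Prop :=
  T ∈ Descriptive.tree (Dig d → Dig d) ∧
    ∀ l : ℕ, (level T l).Finite ∧ OneSided (level T l) ∧ AlmostAcyclic (level T l) ∧
      IsDeltaOneOne (levelCode T l)

/-! ### The concrete tree -/

/-- `0 + 1 + ⋯ + m`. -/
def tri (m : ℕ) : ℕ := ∑ k ∈ Finset.range (m + 1), k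

/-- `M(l)`, the largest `m` with `0 + 1 + ⋯ + m ≤ l`. -/
def diag (l : ℕ) : ℕ := Nat.findGreatest (fun m => tri m ≤ l) l

/-- The pairing `⟨n, p⟩`, with `⟨0, 0⟩ = 0`, `⟨1, 0⟩ = 1`, `⟨0, 1⟩ = 2`, `⟨2, 0⟩ = 3`, … -/
def pr (n p : ℕ) : ℕ := tri (n + p) + p

/-- `(l)_0`, the first component for the pairing. -/
def pr0 (l : ℕ) : ℕ := diag l - (l - tri (diag l))

/-- `(l)_1`, the second component for the pairing. -/
def pr1 (l : ℕ) : ℕ := l - tri (diag l)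

theorem pr0_le (l : ℕ) : pr0 l ≤ l := (Nat.sub_le _ _).trans (Nat.findGreatest_le l)

theorem pr1_le (l : ℕ) : pr1 l ≤ l := Nat.sub_le _ _

/-- The enumeration of the finite sequences of integers `< k`, by increasing length, and
lexicographically for a given length (for `k ≥ 1`): `∅, (0), …, (k - 1), (0, 0), (0, 1), …` -/
def shortlex (k : ℕ) : ℕ → List ℕ
  | 0 => []
  | n + 1 => shortlex k (n / k) ++ [n % k]
  decreasing_by exact Nat.lt_succ_of_le (Nat.div_le_self n k)

/-- `p_0^{s(0)+1} ⋯ p_{|s|-1}^{s(|s|-1)+1}`, where `p_j` is the `j`-th prime number. -/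
def primeCode (s : List ℕ) : ℕ := ∏ j : Fin s.length, Nat.nth Nat.Prime j ^ (s.get j + 1)

/-- The enumeration of the finite sequences of integers by increasing `primeCode`. -/
def primeEnum (n : ℕ) : List ℕ :=
  Function.invFun primeCode (Nat.nth (fun c => c ∈ Set.range primeCode) n)

section

variable {d : ℕ∞} [hd : Fact (2 ≤ d)]

/-- `0 ∈ d`. -/
def dig0 : Dig d := ⟨0, lt_of_lt_of_le (by norm_num) hd.out⟩

/-- `1 ∈ d`. -/
def dig1 : Dig d := ⟨1, lt_of_lt_of_le (by norm_num) hd.out⟩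

/-- An integer `n < d`, as an element of `d` (the value at the other integers is irrelevant). -/
def toDig (n : ℕ) : Dig d := if h : (n : ℕ∞) < d then ⟨n, h⟩ else dig0

open Classical in
variable (d) in
/-- The bijection `b_d` from `ω` onto the set of finite sequences of elements of `d`. -/
def finSeq (n : ℕ) : List (Dig d) :=
  (if d = ⊤ then primeEnum n else shortlex d.toNat n).map toDig

variable (d) in
/-- The sequences `s_l^i` of length `l`: `s_0^i = ∅`, and `s_{l+1}^i = s_q^i i t 0^{l-q-|t|}`, where
`l = ⟨p, ⟨r, ⟨q, n⟩⟩⟩` and `t = b_d(n)`. -/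
def frame : ℕ → Dig d → List (Dig d)
  | 0, _ => []
  | l + 1, i =>
    frame (pr0 (pr1 (pr1 l))) i ++ i :: (finSeq d (pr1 (pr1 (pr1 l))) ++
      List.replicate (l - pr0 (pr1 (pr1 l)) - (finSeq d (pr1 (pr1 (pr1 l)))).length) dig0)
  decreasing_by
    exact Nat.lt_succ_of_le ((pr0_le _).trans ((pr1_le _).trans (pr1_le _)))

variable (d) in
/-- The tree `T_d`: the empty sequence, and the `(s_l^i i t)_{i ∈ d}` whose coordinate `0` is bounded
by the identity. -/
def frameTree : Set (List (Dig d → Dig d)) :=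
  {s | s = [] ∨ ∃ (l : ℕ) (t : List (Dig d)),
    (∀ i, (s.map fun v => v i) = frame d l i ++ i :: t) ∧
      ∀ (n : ℕ) (hn : n < s.length), (s[n] dig0 : ℕ) ≤ n}

end

/-! ### The concrete sets -/

/-- The Cantor space `2^ω`. -/
abbrev Cantor : Type := ℕ → Bool

/-- The shift map. -/
def shift (α : Cantor) : Cantor := fun m => α (m + 1)

open Classical in
/-- The symmetric difference `d^ω × d^ω → 2^ω`. -/
def symDiff {A : Type} (α β : ℕ → A) : Cantor := fun m => decide (α m ≠ β m)

open Classical in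
/-- The map `ρ_0`: `ρ_0(α)(m) = 1` iff `α(⟨m, n⟩) = 0` for every `n`. -/
def rhoZero (α : Cantor) : Cantor := fun m => decide (∀ n, α (pr m n) = false)

/-- The map `ρ_0^{(m,m+1)}`, where `f` stands for `ρ_0^{θ_m}`: it does not change the first `m`
values, and applies `f` to the rest. -/
def tailMap (f : Cantor → Cantor) (m : ℕ) (α : Cantor) : Cantor :=
  fun i => if i < m then α i else f (shift^[m] α) (i - m)

/-- The map `ρ_0^{(0,m)} = ρ_0^{(m-1,m)} ∘ ⋯ ∘ ρ_0^{(0,1)}`, where `f m` stands for `ρ_0^{θ_m}`. -/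
def iterMap (f : ℕ → Cantor → Cantor) : ℕ → Cantor → Cantor
  | 0 => id
  | m + 1 => tailMap (f m) m ∘ iterMap f m

/-- The partial sums `θ_0 + ⋯ + θ_{n-1}`. -/
def partialSum (θ : ℕ → Ordinal.{0}) : ℕ → Ordinal.{0}
  | 0 => 0
  | n + 1 => partialSum θ n + θ n

/-- `θ` chooses, for each countable limit ordinal `η > 0`, a sequence `(θ_m^η)_m` of successor
ordinals smaller than `η` whose sum is `η`. -/
def IsLimitChoice (θ : Ordinal.{0} → ℕ → Ordinal.{0}) : Prop :=
  ∀ η : Ordinal.{0}, Order.IsSuccLimit η → η < ω₁ →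
    (∀ m, θ η m < η ∧ ∃ ζ, θ η m = ζ + 1) ∧ IsLUB (Set.range (partialSum (θ η))) η

theorem exists_limitChoice_at (η : Ordinal.{0}) (h : Order.IsSuccLimit η) (hη : η < ω₁) :
    ∃ θ : ℕ → Ordinal.{0}, (∀ m, θ m < η ∧ ∃ ζ, θ m = ζ + 1) ∧
      IsLUB (Set.range (partialSum θ)) η := by
  have hc : Countable (Set.Iio η) := by
    have h1 : η.card < Cardinal.aleph 1 := by
      rw [← Cardinal.lt_ord, Cardinal.ord_aleph]
      exact hη
    have h2 : η.card ≤ Cardinal.aleph0 := by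
      rw [← Order.lt_succ_iff, ← Cardinal.aleph_zero, Cardinal.succ_aleph]
      simpa using h1
    rw [← Cardinal.mk_le_aleph0_iff, Cardinal.mk_Iio_ordinal]
    exact Cardinal.lift_le_aleph0.2 h2
  have hpos : (0 : Ordinal) < η := by simpa using h.bot_lt
  have : Nonempty (Set.Iio η) := ⟨⟨0, hpos⟩⟩
  obtain ⟨g, hg⟩ := exists_surjective_nat (Set.Iio η)
  let u : ℕ → Ordinal.{0} := fun n => Nat.rec ((g 0).1 + 1) (fun n a => max a (g (n + 1)).1 + 1) n
  have hu1 : ∀ n, u (n + 1) = max (u n) (g (n + 1)).1 + 1 := fun n => rfl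
  have hlim : ∀ a, a < η → a + 1 < η := fun a ha => by simpa using h.succ_lt ha
  have hlt : ∀ n, u n < η := by
    intro n
    induction n with
    | zero => exact hlim _ (g 0).2
    | succ n ih => rw [hu1]; exact hlim _ (max_lt ih (g (n + 1)).2)
  have hmono : ∀ n, u n < u (n + 1) := by
    intro n
    rw [hu1]
    exact lt_of_le_of_lt (le_max_left _ _) (lt_add_one _)
  have hgu : ∀ n, (g n).1 < u n := by
    intro n
    cases n with
    | zero => exact lt_add_one _
    | succ n => rw [hu1]; exact lt_of_le_of_lt (le_max_right _ _) (lt_add_one _)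
  let θ : ℕ → Ordinal.{0} := fun n => Nat.casesOn n (u 0) fun n => u (n + 1) - u n
  have hsum : ∀ n, partialSum θ (n + 1) = u n := by
    intro n
    induction n with
    | zero => simp [partialSum, θ]
    | succ n ih =>
      rw [partialSum, ih]
      exact Ordinal.add_sub_cancel_of_le (hmono n).le
  refine ⟨θ, ?_, ?_, ?_⟩
  · intro m
    cases m with
    | zero => exact ⟨hlt 0, _, rfl⟩
    | succ m =>
      refine ⟨lt_of_le_of_lt (Ordinal.sub_le_self _ _) (hlt (m + 1)), ?_⟩
      refine ⟨max (u m) (g (m + 1)).1 - u m, ?_⟩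
      change u (m + 1) - u m = _
      apply Ordinal.sub_eq_of_add_eq
      rw [← add_assoc, Ordinal.add_sub_cancel_of_le (le_max_left _ _), hu1]
  · rintro _ ⟨n, rfl⟩
    cases n with
    | zero => exact hpos.le
    | succ n => rw [hsum]; exact (hlt n).le
  · intro b hb
    by_contra hlt'
    rw [not_le] at hlt'
    obtain ⟨n, hn⟩ := hg ⟨b, hlt'⟩
    have h1 := hgu n
    rw [hn] at h1
    exact absurd (hb ⟨n + 1, hsum n⟩) (not_le.2 h1)

/-- Such choices exist. -/
theorem exists_isLimitChoice : ∃ θ, IsLimitChoice θ := by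
  classical
  refine ⟨fun η => if h : Order.IsSuccLimit η ∧ η < ω₁ then
    (exists_limitChoice_at η h.1 h.2).choose else fun _ => 0, ?_⟩
  intro η h1 h2
  beta_reduce
  rw [dif_pos ⟨h1, h2⟩]
  exact (exists_limitChoice_at η h1 h2).choose_spec

open Classical in
/-- The maps `ρ_0^η`: `ρ_0^0` is the identity, `ρ_0^{η+1} = ρ_0 ∘ ρ_0^η`, and at a limit `η`,
`ρ_0^η(α)(m) = ρ_0^{(0,m+1)}(α)(m)`, computed with the maps `ρ_0^{θ_m^η}`. -/
def rho (θ : Ordinal.{0} → ℕ → Ordinal.{0}) (η : Ordinal.{0}) : Cantor → Cantor :=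
  Ordinal.limitRecOn (motive := fun _ => Cantor → Cantor) η id (fun _ f => rhoZero ∘ f)
    (fun η _ f α m =>
      iterMap (fun k => if h : θ η k < η then f (θ η k) h else id) (m + 1) α m)

/-- `C_ξ`, for `ξ = 1 + η`: the complement of the inverse image of `{0^∞}` by `ρ_0^η`.  (Here
`ξ - 1` is the ordinal `η` with `1 + η = ξ`.) -/
def CSet (θ : Ordinal.{0} → ℕ → Ordinal.{0}) (ξ : Ordinal.{0}) : Set Cantor :=
  (rho θ (ξ - 1) ⁻¹' {fun _ => false})ᶜ

/-- `C_ξ^ε`, for `ξ = 1 + η`: the first `m` with `ρ_0^η(α)(m) = 1` exists, and `(m)_0 ≡ ε` mod `2`. -/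
def CSetPar (θ : Ordinal.{0} → ℕ → Ordinal.{0}) (ξ : Ordinal.{0}) (ε : Fin 2) : Set Cantor :=
  {α | ∃ m, rho θ (ξ - 1) α m = true ∧ (∀ l < m, rho θ (ξ - 1) α l = false) ∧ pr0 m % 2 = ε}

variable (d : ℕ∞) [Fact (2 ≤ d)] in
/-- `S_C^d`: the branches `(α_i)_{i ∈ d}` of `T_d` such that the shift of the symmetric difference of
`α_0` and `α_1` is in `C`. -/
def SSet (C : Set Cantor) : Set (Dig d → ℕ → Dig d) :=
  {α | α ∈ body (frameTree d) ∧ shift (symDiff (α dig0) (α dig1)) ∈ C}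

end PotWadge

end

/-!
The levels of `T_d` are understood by induction: the elements of level `l + 1` extend elements of level
`l` by a digit which does not depend on the coordinate, with the only exception of
`(s_l^i i)_{i ∈ d}` (`FrameNode`). Two elements sharing two coordinates are therefore equal, and a cycle
either comes from the level below, or passes through the exceptional element, whose two neighbours then
share with it the same coordinate (`FrameNode.exists_common_of_cycle`). A level is finite because the
coordinate `0` is bounded, and it consists of primitive recursive points, so it is `Δ¹_1`.

On the Cantor space, the fact that `C_ξ` is `Σ⁰_ξ` but not `Π⁰_ξ`, and that no `Δ⁰_ξ` set separates
`C_ξ^0` from `C_ξ^1`, comes from a universality property of `ρ_0^η` (`RowUniversal.rho`): if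
`ξ = 1 + η`, then any sequence of `Σ⁰_ξ` sets can be read on the rows of `ρ_0^η ∘ g`, for a map `g` such
that `g(α)(n)` depends on `α(0), …, α(n - 1)` only. At limit stages each coordinate is treated
separately, and the maps `g` are put together because the coordinates of `ρ_0^η(α)` depend on disjoint
sets of coordinates of `α` (`indepCoords_rho`). A map like `g` has a fixed point, so a `Π⁰_ξ` set equal
to `C_ξ`, or a `Δ⁰_ξ` set separating `C_ξ^0` from `C_ξ^1`, leads to a contradiction by diagonalization.

It remains to transfer these facts to `[T_d]`, in spite of the finer topologies `τ_i` on the factors.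
Each `τ_i` coincides with the usual topology on a countable intersection of dense open subsets of the
compact set `boundedSeqs i` containing the `i`-th coordinates of the branches
(`exists_dense_open_seq`). Since every node is extended by some frame `s_l`, where the first
component of `l - 1` can be prescribed, one can build a map `f` from the Cantor space into
`[T_d]`, continuous for the `τ_i`, whose values split exactly at levels which code the ones of the
argument (`exists_reduction`). Only the first components and the order of these ones matter for
membership in `C_ξ` and `C_ξ^ε`: for `η ≥ 1` the map `ρ_0^η` factors through `ρ_0`. Hence `f` pulls
potential separations back to separations of the corresponding class on the Cantor space.
-/

namespace PotWadge

/-! ### The pairing of integers -/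

theorem tri_succ (m : ℕ) : tri (m + 1) = tri m + (m + 1) := Finset.sum_range_succ _ _

theorem le_tri (m : ℕ) : m ≤ tri m := by
  cases m with
  | zero => exact Nat.zero_le _
  | succ m => rw [tri_succ]; omega

theorem tri_mono : Monotone tri :=
  monotone_nat_of_le_succ fun m => by rw [tri_succ]; omega

theorem le_pr_left (m n : ℕ) : m ≤ pr m n := by
  have := le_tri (m + n)
  unfold pr
  omega

theorem le_pr_right (m n : ℕ) : n ≤ pr m n := Nat.le_add_left _ _

theorem diag_pr (m n : ℕ) : diag (pr m n) = m + n := by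
  unfold diag
  rw [Nat.findGreatest_eq_iff]
  refine ⟨(le_tri _).trans (Nat.le_add_right _ _), fun _ => Nat.le_add_right _ _, ?_⟩
  intro k hk _ h
  have h1 : tri (m + n + 1) ≤ tri k := tri_mono hk
  rw [tri_succ] at h1
  unfold pr at h
  omega

@[simp] theorem pr1_pr (m n : ℕ) : pr1 (pr m n) = n := by
  rw [pr1, diag_pr, pr, Nat.add_sub_cancel_left]

@[simp] theorem pr0_pr (m n : ℕ) : pr0 (pr m n) = m := by
  rw [pr0, diag_pr, pr, Nat.add_sub_cancel_left, Nat.add_sub_cancel]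

theorem pr_pr0_pr1 (l : ℕ) : pr (pr0 l) (pr1 l) = l := by
  have h1 : tri (diag l) ≤ l :=
    Nat.findGreatest_spec (P := fun m => tri m ≤ l) (Nat.zero_le l) (Nat.zero_le l)
  have h2 : l < tri (diag l) + (diag l + 1) := by
    rw [← tri_succ]
    by_contra! h
    have h3 : diag l + 1 ≤ diag l :=
      Nat.le_findGreatest (P := fun m => tri m ≤ l) ((le_tri _).trans h) h
    omega
  unfold pr pr0 pr1
  rw [Nat.sub_add_cancel (by omega)]
  omega

/-! ### The additive Borel classes -/

section SigmaZero

variable {X : Type} [TopologicalSpace X] {ξ η : Ordinal.{0}} {A B : Set X}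

theorem SigmaZero.cases_on (h : SigmaZero ξ A) :
    (ξ = 1 ∧ IsOpen A) ∨ (1 < ξ ∧ ∃ (η : ℕ → Ordinal.{0}) (B : ℕ → Set X),
      (∀ n, 1 ≤ η n) ∧ (∀ n, η n < ξ) ∧ (∀ n, SigmaZero (η n) (B n)) ∧ A = ⋃ n, (B n)ᶜ) := by
  cases h with
  | of_isOpen _ h => exact Or.inl ⟨rfl, h⟩
  | iUnion_compl _ η B h h1 h2 h3 => exact Or.inr ⟨h, η, B, h1, h2, h3, rfl⟩

theorem SigmaZero.isOpen (h : SigmaZero 1 A) : IsOpen A := by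
  rcases h.cases_on with h | h
  · exact h.2
  · exact absurd h.1 (lt_irrefl _)

theorem SigmaZero.one_le (h : SigmaZero ξ A) : 1 ≤ ξ := by
  rcases h.cases_on with h | h
  · exact h.1.ge
  · exact h.1.le

theorem SigmaZero.preimage {Y : Type} [TopologicalSpace Y] {f : Y → X} (hf : Continuous f)
    (h : SigmaZero ξ A) : SigmaZero ξ (f ⁻¹' A) := by
  induction h with
  | of_isOpen U hU => exact .of_isOpen _ (hU.preimage hf)
  | iUnion_compl ξ η B h h1 h2 h3 ih =>
    rw [Set.preimage_iUnion]
    exact .iUnion_compl ξ η _ h h1 h2 ih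

theorem SigmaZero.iUnion {A : ℕ → Set X} (h : ∀ n, SigmaZero ξ (A n)) :
    SigmaZero ξ (⋃ n, A n) := by
  rcases (h 0).one_le.eq_or_lt with rfl | hξ
  · exact .of_isOpen _ (isOpen_iUnion fun n => (h n).isOpen)
  · have h' : ∀ n, ∃ (η : ℕ → Ordinal.{0}) (B : ℕ → Set X),
        (∀ n, 1 ≤ η n) ∧ (∀ n, η n < ξ) ∧ (∀ n, SigmaZero (η n) (B n)) ∧ A n = ⋃ n, (B n)ᶜ := by
      intro n
      rcases (h n).cases_on with h | h
      · exact absurd h.1 hξ.ne'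
      · exact h.2
    choose η B h1 h2 h3 h4 using h'
    have : ⋃ n, A n = ⋃ k : ℕ, (B k.unpair.1 k.unpair.2)ᶜ := by
      rw [Set.iUnion_unpair fun i j => (B i j)ᶜ]
      exact Set.iUnion_congr h4
    rw [this]
    exact .iUnion_compl ξ (fun k => η k.unpair.1 k.unpair.2) _ hξ (fun _ => h1 _ _)
      (fun _ => h2 _ _) fun _ => h3 _ _

theorem SigmaZero.union (hA : SigmaZero ξ A) (hB : SigmaZero ξ B) : SigmaZero ξ (A ∪ B) := by
  have : A ∪ B = ⋃ n : ℕ, if n = 0 then A else B := by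
    ext x
    simp only [Set.mem_union, Set.mem_iUnion]
    constructor
    · rintro (h | h)
      · exact ⟨0, by simpa using h⟩
      · exact ⟨1, by simpa using h⟩
    · rintro ⟨n, hn⟩
      split_ifs at hn
      · exact Or.inl hn
      · exact Or.inr hn
  rw [this]
  refine .iUnion fun n => ?_
  split_ifs
  · exact hA
  · exact hB

theorem SigmaZero.empty (hξ : 1 ≤ ξ) : SigmaZero ξ (∅ : Set X) := by
  rcases hξ.eq_or_lt with rfl | hξ
  · exact .of_isOpen _ isOpen_empty
  · have := SigmaZero.iUnion_compl (X := X) ξ (fun _ => 1) (fun _ => Set.univ) hξ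
      (fun _ => le_rfl) (fun _ => hξ) fun _ => .of_isOpen _ isOpen_univ
    simpa using this

theorem SigmaZero.univ (hξ : 1 ≤ ξ) : SigmaZero ξ (Set.univ : Set X) := by
  rcases hξ.eq_or_lt with rfl | hξ
  · exact .of_isOpen _ isOpen_univ
  · have := SigmaZero.iUnion_compl (X := X) ξ (fun _ => 1) (fun _ => ∅) hξ
      (fun _ => le_rfl) (fun _ => hξ) fun _ => .of_isOpen _ isOpen_empty
    simpa [Set.iUnion_const] using this

open TopologicalSpace in
/-- In a metrizable space the open sets are `F_σ`, so that the classes `Σ⁰_ξ` increase with `ξ`. -/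
theorem SigmaZero.mono [MetrizableSpace X] (h : SigmaZero η A) (hle : η ≤ ξ) : SigmaZero ξ A := by
  rcases hle.eq_or_lt with rfl | hlt
  · exact h
  rcases h.cases_on with ⟨rfl, hA⟩ | ⟨h0, ζ, B, h1, h2, h3, rfl⟩
  · let := metrizableSpaceMetric X
    obtain ⟨F, hF, -, hU, -⟩ := hA.exists_iUnion_isClosed
    have : A = ⋃ n, ((F n)ᶜ)ᶜ := by simp [hU]
    rw [this]
    exact .iUnion_compl ξ (fun _ => 1) _ hlt (fun _ => le_rfl) (fun _ => hlt)
      fun n => .of_isOpen _ (hF n).isOpen_compl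
  · exact .iUnion_compl ξ ζ B (h0.trans hlt) h1 (fun n => (h2 n).trans hlt) h3

theorem SigmaZero.compl_of_lt (h : SigmaZero η A) (hlt : η < ξ) : SigmaZero ξ Aᶜ := by
  rw [← Set.iUnion_const (ι := ℕ) Aᶜ]
  exact .iUnion_compl ξ (fun _ => η) (fun _ => A) (h.one_le.trans_lt hlt)
    (fun _ => h.one_le) (fun _ => hlt) fun _ => h

open TopologicalSpace in
theorem SigmaZero.inter [MetrizableSpace X] (hA : SigmaZero ξ A) (hB : SigmaZero ξ B) :
    SigmaZero ξ (A ∩ B) := by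
  rcases hA.cases_on with ⟨rfl, hA'⟩ | ⟨h0, η, A', h1, h2, h3, rfl⟩
  · exact .of_isOpen _ (hA'.inter hB.isOpen)
  rcases hB.cases_on with ⟨rfl, -⟩ | ⟨-, ζ, B', k1, k2, k3, rfl⟩
  · exact absurd h0 (lt_irrefl _)
  have : (⋃ n, (A' n)ᶜ) ∩ (⋃ n, (B' n)ᶜ) = ⋃ n, ⋃ m, (A' n ∪ B' m)ᶜ := by
    simp only [Set.iUnion_inter_iUnion, Set.compl_union]
  rw [this]
  refine .iUnion fun n => .iUnion fun m => ?_
  exact (((h3 n).mono (le_max_left _ _)).union ((k3 m).mono (le_max_right _ _))).compl_of_lt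
    (max_lt (h2 n) (k2 m))

end SigmaZero

/-! ### The maps `ρ_0^η` -/

section Rho

variable {θ : Ordinal.{0} → ℕ → Ordinal.{0}} {η ξ : Ordinal.{0}} {σ τ : Cantor → Cantor}

theorem rhoZero_eq_true {α : Cantor} {m : ℕ} :
    rhoZero α m = true ↔ ∀ n, α (pr m n) = false := by
  simp [rhoZero]

theorem rhoZero_eq_false {α : Cantor} {m : ℕ} :
    rhoZero α m = false ↔ ∃ n, α (pr m n) = true := by
  simp [rhoZero]

theorem rho_zero : rho θ 0 = id := by
  unfold rho
  exact Ordinal.limitRecOn_zero ..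

theorem rho_succ : rho θ (η + 1) = rhoZero ∘ rho θ η := by
  unfold rho
  exact Ordinal.limitRecOn_add_one ..

theorem rho_limit (h : Order.IsSuccLimit η) (hθ : ∀ k, θ η k < η) (α : Cantor) (m : ℕ) :
    rho θ η α m = iterMap (fun k => rho θ (θ η k)) (m + 1) α m := by
  unfold rho
  rw [Ordinal.limitRecOn_limit _ _ _ _ h]
  simp only [hθ, dite_true]

/-- The tails of the maps `ρ_0^{(0,m)}`: they satisfy `σ_0 = Id` and `σ_{m+1} = 𝒮 ∘ f_m ∘ σ_m`, and
the coordinate `m` of `ρ_0^{(0,m+1)}` is the coordinate `0` of `f_m ∘ σ_m`. -/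
def tailIter (f : ℕ → Cantor → Cantor) : ℕ → Cantor → Cantor
  | 0 => id
  | m + 1 => shift ∘ f m ∘ tailIter f m

theorem iterate_shift_apply (m : ℕ) (α : Cantor) (i : ℕ) : shift^[m] α i = α (i + m) := by
  induction m generalizing α with
  | zero => rfl
  | succ m ih => rw [Function.iterate_succ_apply, ih, shift, add_assoc]

theorem tailMap_add (f : Cantor → Cantor) (m : ℕ) (α : Cantor) (i : ℕ) :
    tailMap f m α (i + m) = f (shift^[m] α) i := by
  simp [tailMap]

theorem shift_iterMap (f : ℕ → Cantor → Cantor) (m : ℕ) (α : Cantor) :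
    shift^[m] (iterMap f m α) = tailIter f m α := by
  induction m with
  | zero => rfl
  | succ m ih =>
    funext i
    rw [iterate_shift_apply, iterMap, Function.comp_apply, ← add_assoc, add_right_comm,
      tailMap_add, ih]
    rfl

theorem iterMap_succ_self (f : ℕ → Cantor → Cantor) (m : ℕ) (α : Cantor) :
    iterMap f (m + 1) α m = f m (tailIter f m α) 0 := by
  have := tailMap_add (f m) m (iterMap f m α) 0
  rwa [zero_add, shift_iterMap] at this

theorem rho_limit_apply (h : Order.IsSuccLimit η) (hθ : ∀ k, θ η k < η) (α : Cantor) (m : ℕ) :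
    rho θ η α m = rho θ (θ η m) (tailIter (fun k => rho θ (θ η k)) m α) 0 := by
  rw [rho_limit h hθ, iterMap_succ_self]

theorem eq_zero_or_add_one_or_isSuccLimit (η : Ordinal.{0}) :
    η = 0 ∨ (∃ ζ, η = ζ + 1) ∨ Order.IsSuccLimit η := by
  rcases Ordinal.zero_or_succ_or_isSuccLimit η with h | ⟨ζ, h⟩ | h
  · exact Or.inl h
  · exact Or.inr (Or.inl ⟨ζ, h.symm.trans (Order.succ_eq_add_one ζ)⟩)
  · exact Or.inr (Or.inr h)

/-- For `η ≥ 1` the map `ρ_0^η` factors through `ρ_0`. -/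
theorem rho_congr (hθ : IsLimitChoice θ) (h1 : 1 ≤ η) (hη : η < ω₁) {α β : Cantor}
    (h : rhoZero α = rhoZero β) : rho θ η α = rho θ η β := by
  induction η using WellFoundedLT.induction with
  | _ η ih =>
  rcases eq_zero_or_add_one_or_isSuccLimit η with rfl | ⟨ζ, rfl⟩ | hl
  · simp at h1
  · rcases eq_or_ne ζ 0 with rfl | hζ
    · simp only [rho_succ, rho_zero]
      exact h
    · rw [rho_succ]
      have := ih ζ (lt_add_one _) (Order.one_le_iff_ne_zero.2 hζ) ((lt_add_one _).trans hη)
      exact congrArg rhoZero this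
  · have hθ' := (hθ η hl hη).1
    have key : ∀ m, rho θ (θ η m) (tailIter (fun k => rho θ (θ η k)) m α) =
        rho θ (θ η m) (tailIter (fun k => rho θ (θ η k)) m β) := by
      intro m
      induction m with
      | zero =>
        obtain ⟨ζ, hζ⟩ := (hθ' 0).2
        refine ih _ (hθ' 0).1 ?_ ((hθ' 0).1.trans hη)
        rw [hζ]
        exact le_add_self
      | succ m ihm =>
        simp only [tailIter, Function.comp_apply]
        rw [ihm]
    funext m
    rw [rho_limit_apply hl fun k => (hθ' k).1, rho_limit_apply hl fun k => (hθ' k).1, key]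

/-! ### Membership in the additive classes -/

/-- Each coordinate of `σ` is the characteristic function of a `Δ⁰_ξ` set. -/
def CoordDelta (σ : Cantor → Cantor) (ξ : Ordinal.{0}) : Prop :=
  ∀ m b, SigmaZero ξ {α | σ α m = b}

/-- Each coordinate of `σ` is the characteristic function of a `Π⁰_ξ` set. -/
def CoordPi (σ : Cantor → Cantor) (ξ : Ordinal.{0}) : Prop :=
  ∀ m, SigmaZero ξ {α | σ α m = false}

theorem setOf_eq_true (σ : Cantor → Cantor) (m : ℕ) :
    {α | σ α m = true} = {α | σ α m = false}ᶜ := by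
  ext α
  simp

theorem CoordPi.lift_lt (h : CoordPi σ ξ) (hlt : ξ < η) : CoordDelta σ η := by
  rintro m (_ | _)
  · exact (h m).mono hlt.le
  · rw [setOf_eq_true]
    exact (h m).compl_of_lt hlt

theorem CoordDelta.coordPi_rhoZero (h : CoordDelta σ ξ) : CoordPi (rhoZero ∘ σ) ξ := by
  intro m
  simp only [Function.comp_apply, rhoZero_eq_false, Set.ofPred_exists]
  exact .iUnion fun n => h _ _

theorem CoordDelta.shift (h : CoordDelta σ ξ) : CoordDelta (shift ∘ σ) ξ := fun _ _ => h _ _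

theorem coordDelta_id : CoordDelta id 1 := fun m b =>
  .of_isOpen _ ((isOpen_discrete ({b} : Set Bool)).preimage
    (continuous_apply (A := fun _ : ℕ => Bool) m))

theorem partialSum_succ (θ : ℕ → Ordinal.{0}) (m : ℕ) :
    partialSum θ (m + 1) = partialSum θ m + θ m := rfl

theorem partialSum_mono (θ : ℕ → Ordinal.{0}) : Monotone (partialSum θ) :=
  monotone_nat_of_le_succ fun _ => le_self_add

/-- Composition with `ρ_0^η` raises the class of the coordinates by `η`; at a successor `ζ + 1` they are
even in the multiplicative class given by `ζ`. -/
theorem CoordDelta.rho (hθ : IsLimitChoice θ) (hη : η < ω₁) (h : CoordDelta σ ξ) :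
    CoordDelta (rho θ η ∘ σ) (ξ + η) ∧
      ∀ ζ, η = ζ + 1 → CoordPi (PotWadge.rho θ η ∘ σ) (ξ + ζ) := by
  induction η using WellFoundedLT.induction generalizing σ ξ with
  | _ η ih =>
  rcases eq_zero_or_add_one_or_isSuccLimit η with rfl | ⟨ζ, rfl⟩ | hl
  · refine ⟨by simpa [rho_zero] using h, fun ζ hζ => ?_⟩
    exact absurd hζ.symm (by simp)
  · have h1 := ((ih ζ (lt_add_one _) ((lt_add_one _).trans hη) h).1).coordPi_rhoZero
    refine ⟨?_, ?_⟩
    · rw [rho_succ]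
      exact CoordPi.lift_lt h1 (by simp)
    · intro ζ' hζ'
      obtain rfl : ζ = ζ' := by simpa using hζ'
      rw [rho_succ]
      exact h1
  · obtain ⟨hθ', hlub⟩ := hθ η hl hη
    set f : ℕ → Cantor → Cantor := fun k => PotWadge.rho θ (θ η k) with hf
    have key : ∀ m, CoordDelta (tailIter f m ∘ σ) (ξ + partialSum (θ η) m) := by
      intro m
      induction m with
      | zero => simpa [tailIter, partialSum] using h
      | succ m ihm =>
        rw [partialSum_succ, ← add_assoc]
        exact (ih _ (hθ' m).1 ((hθ' m).1.trans hη) ihm).1.shift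
    refine ⟨fun m b => ?_, ?_⟩
    · have h1 := (ih _ (hθ' m).1 ((hθ' m).1.trans hη) (key m)).1 0 b
      have h2 : ξ + partialSum (θ η) m + θ η m ≤ ξ + η := by
        rw [add_assoc, ← partialSum_succ]
        gcongr
        exact hlub.1 ⟨_, rfl⟩
      simpa [rho_limit_apply hl fun k => (hθ' k).1] using h1.mono h2
    · rintro ζ rfl
      exact absurd hl (by simp)

theorem add_sub_of_one_le (h : 1 ≤ ξ) : 1 + (ξ - 1) = ξ := Ordinal.add_sub_cancel_of_le h

theorem coordDelta_rho (hθ : IsLimitChoice θ) (h1 : 1 ≤ ξ) (hξ : ξ < ω₁) :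
    CoordDelta (PotWadge.rho θ (ξ - 1)) ξ := by
  have := (coordDelta_id.rho hθ ((Ordinal.sub_le_self ξ 1).trans_lt hξ)).1
  rwa [add_sub_of_one_le h1, Function.comp_id] at this

theorem mem_CSet {α : Cantor} : α ∈ CSet θ ξ ↔ ∃ m, PotWadge.rho θ (ξ - 1) α m = true := by
  simp [CSet, funext_iff]

theorem sigmaZero_CSet (hθ : IsLimitChoice θ) (h1 : 1 ≤ ξ) (hξ : ξ < ω₁) :
    SigmaZero ξ (CSet θ ξ) := by
  have : CSet θ ξ = ⋃ m, {α | PotWadge.rho θ (ξ - 1) α m = true} := by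
    ext α
    simp [mem_CSet]
  rw [this]
  exact .iUnion fun m => coordDelta_rho hθ h1 hξ m true

theorem sigmaZero_CSetPar (hθ : IsLimitChoice θ) (h1 : 1 ≤ ξ) (hξ : ξ < ω₁) (ε : Fin 2) :
    SigmaZero ξ (CSetPar θ ξ ε) := by
  have h := coordDelta_rho hθ h1 hξ
  have hfin : ∀ m, SigmaZero ξ {α | ∀ l < m, PotWadge.rho θ (ξ - 1) α l = false} := by
    intro m
    induction m with
    | zero => simpa using SigmaZero.univ h1
    | succ m ih =>
      convert ih.inter (h m false) using 1
      ext α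
      exact Nat.forall_lt_succ_right
  have : CSetPar θ ξ ε = ⋃ m, if pr0 m % 2 = ε then
      {α | PotWadge.rho θ (ξ - 1) α m = true} ∩
        {α | ∀ l < m, PotWadge.rho θ (ξ - 1) α l = false} else ∅ := by
    ext α
    simp only [CSetPar, Set.mem_ofPred_eq, Set.mem_iUnion]
    refine exists_congr fun m => ?_
    by_cases hm : pr0 m % 2 = ε <;> simp [hm]
  rw [this]
  refine .iUnion fun m => ?_
  split_ifs
  · exact (h m true).inter (hfin m)
  · exact .empty h1

theorem disjoint_CSetPar : Disjoint (CSetPar θ ξ 0) (CSetPar θ ξ 1) := by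
  rw [Set.disjoint_left]
  rintro α ⟨m, h1, h2, h3⟩ ⟨n, k1, k2, k3⟩
  rcases lt_trichotomy m n with h | rfl | h
  · simp [k2 m h] at h1
  · simp at h3 k3
    omega
  · simp [h2 n h] at k1

end Rho

/-! ### Strictly causal maps, and universality of the maps `ρ_0^η` -/

/-- `g(α)(n)` depends on `α(0), …, α(n - 1)` only: `g` is induced by a strategy of the player who moves
first in the Lipschitz game. -/
def StrictlyCausal (g : Cantor → Cantor) : Prop :=
  ∀ (n : ℕ) (α β : Cantor), (∀ k < n, α k = β k) → g α n = g β n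

theorem StrictlyCausal.exists_fixedPoint {g : Cantor → Cantor} (hg : StrictlyCausal g) :
    ∃ α, g α = α := by
  let x : ℕ → Cantor := fun n => g^[n] fun _ => false
  have hx : ∀ n, x (n + 1) = g (x n) := fun n => Function.iterate_succ_apply' g n _
  have key : ∀ n m, n ≤ m → ∀ k < n, x m k = x n k := by
    intro n
    induction n with
    | zero => intro m _ k hk; omega
    | succ n ih =>
      intro m hm k hk
      obtain ⟨m, rfl⟩ : ∃ m', m = m' + 1 := ⟨m - 1, by omega⟩
      rw [hx, hx]
      exact hg k _ _ fun j hj => ih m (by omega) j (by omega)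
  refine ⟨fun k => x (k + 1) k, funext fun k => ?_⟩
  rw [hx k]
  exact hg k _ _ fun j hj => (key (j + 1) k hj j (by omega)).symm

/-- The coordinate `m` of `σ(α)` depends only on the restriction of `α` to the fibre of `m` under some
`π : ω → ω`. -/
def IndepCoords (σ : Cantor → Cantor) : Prop :=
  ∃ π : ℕ → ℕ, (∀ k, π k ≤ k) ∧
    ∀ (m : ℕ) (α β : Cantor), (∀ k, π k = m → α k = β k) → σ α m = σ β m

/-- Every sequence of `Σ⁰_ξ` sets can be read on the rows of `σ`, after a strictly causal map. -/
def RowUniversal (σ : Cantor → Cantor) (ξ : Ordinal.{0}) : Prop :=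
  ∀ A : ℕ → Set Cantor, (∀ j, SigmaZero ξ (A j)) →
    ∃ g, StrictlyCausal g ∧ ∀ α j, α ∈ A j ↔ ∃ n, σ (g α) (pr j n) = true

/-- Every sequence of `Π⁰_ξ` sets can be read on the coordinates of `σ`, after a strictly causal
map. -/
def CoordUniversal (σ : Cantor → Cantor) (ξ : Ordinal.{0}) : Prop :=
  ∀ B : ℕ → Set Cantor, (∀ j, SigmaZero ξ (B j)ᶜ) →
    ∃ g, StrictlyCausal g ∧ ∀ α j, σ (g α) j = true ↔ α ∈ B j

variable {θ : Ordinal.{0} → ℕ → Ordinal.{0}} {η ξ : Ordinal.{0}} {σ τ : Cantor → Cantor}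

theorem indepCoords_id : IndepCoords id := ⟨id, fun _ => le_rfl, fun m _ _ h => h m rfl⟩

theorem IndepCoords.comp (hσ : IndepCoords σ) (hτ : IndepCoords τ) : IndepCoords (σ ∘ τ) := by
  obtain ⟨p, hp, hp'⟩ := hσ
  obtain ⟨q, hq, hq'⟩ := hτ
  refine ⟨p ∘ q, fun k => (hp _).trans (hq _), fun m α β h => hp' m _ _ fun k hk => ?_⟩
  exact hq' k _ _ fun j hj => h j (by simp [hj, hk])

theorem indepCoords_rhoZero : IndepCoords rhoZero := by
  refine ⟨pr0, pr0_le, fun m α β h => ?_⟩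
  have : ∀ n, α (pr m n) = β (pr m n) := fun n => h _ (pr0_pr m n)
  simp [rhoZero, this]

theorem indepCoords_shift : IndepCoords shift :=
  ⟨fun k => k - 1, fun k => Nat.sub_le k 1, fun m _ _ h => h (m + 1) rfl⟩

theorem tailIter_indepCoords {f : ℕ → Cantor → Cantor} (hf : ∀ k, IndepCoords (f k)) (m : ℕ) :
    IndepCoords (tailIter f m) := by
  induction m with
  | zero => exact indepCoords_id
  | succ m ih => exact indepCoords_shift.comp ((hf m).comp ih)

theorem indepCoords_rho (hθ : IsLimitChoice θ) (hη : η < ω₁) : IndepCoords (rho θ η) := by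
  induction η using WellFoundedLT.induction with
  | _ η ih =>
  rcases eq_zero_or_add_one_or_isSuccLimit η with rfl | ⟨ζ, rfl⟩ | hl
  · rw [rho_zero]
    exact indepCoords_id
  · rw [rho_succ]
    exact indepCoords_rhoZero.comp (ih ζ (lt_add_one _) ((lt_add_one _).trans hη))
  · have hθ' := (hθ η hl hη).1
    have hind : ∀ k, IndepCoords (rho θ (θ η k)) := fun k =>
      ih _ (hθ' k).1 ((hθ' k).1.trans hη)
    choose p hp hp' using hind
    -- `q n` controls `ρ_0^{(0,n)}`: it acts on the integers `≥ n` only, through a shifted copy of `p n`.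
    let q : ℕ → ℕ → ℕ := fun n => Nat.rec (motive := fun _ => ℕ → ℕ) id
      (fun n a k => if a k < n then a k else n + p n (a k - n)) n
    have hq : ∀ n k : ℕ, q (n + 1) k = if q n k < n then q n k else n + p n (q n k - n) :=
      fun n k => rfl
    have hqle : ∀ n k, q n k ≤ k := by
      intro n k
      induction n with
      | zero => exact le_rfl
      | succ n ihn =>
        rw [hq]
        split_ifs
        · exact ihn
        · have := hp n (q n k - n)
          omega
    have hfix : ∀ n n' k, q n k < n → n ≤ n' → q n' k = q n k := by
      intro n n' k h hle
      induction n', hle using Nat.le_induction with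
      | base => rfl
      | succ n' hle ihn => rw [hq, if_pos (by omega), ihn]
    have hmain : ∀ n m α β, (∀ k, q n k = m → α k = β k) →
        iterMap (fun k => rho θ (θ η k)) n α m = iterMap (fun k => rho θ (θ η k)) n β m := by
      intro n
      induction n with
      | zero => intro m α β h; exact h m rfl
      | succ n ihn =>
        intro m α β h
        simp only [iterMap, Function.comp_apply, tailMap]
        split_ifs with hm
        · refine ihn m α β fun k hk => h k ?_
          rw [hq, if_pos (by omega), hk]
        · refine hp' n _ _ _ fun k hk => ?_
          rw [iterate_shift_apply, iterate_shift_apply]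
          refine ihn _ α β fun j hj => h j ?_
          rw [hq, if_neg (by omega), hj, Nat.add_sub_cancel, hk]
          omega
    refine ⟨fun k => q (k + 1) k, fun k => hqle (k + 1) k, fun m α β h => ?_⟩
    rw [rho_limit hl fun k => (hθ' k).1, rho_limit hl fun k => (hθ' k).1]
    refine hmain _ _ _ _ fun k hk => h k ?_
    have h1 := hfix (m + 1) (max (m + 1) (k + 1)) k (by omega) (le_max_left _ _)
    have h2 := hfix (k + 1) (max (m + 1) (k + 1)) k (Nat.lt_succ_of_le (hqle (k + 1) k))
      (le_max_right _ _)
    exact h2.symm.trans (h1.trans hk)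

open Classical in
/-- The witness for an open set `A` is `g(α)(n) = 1` iff the basic clopen set given by
`α(0), …, α(n - 1)` is contained in `A`. -/
theorem rowUniversal_id : RowUniversal id 1 := by
  intro A hA
  refine ⟨fun α n => decide (∀ β : Cantor, (∀ k < n, β k = α k) → β ∈ A (pr0 n)), ?_, ?_⟩
  · intro n α β h
    simp only [decide_eq_decide]
    refine forall_congr' fun γ => ?_
    have : (∀ k < n, γ k = α k) ↔ ∀ k < n, γ k = β k :=
      forall₂_congr fun k hk => by rw [h k hk]
    rw [this]
  · intro α j
    simp only [id_eq, decide_eq_true_eq, pr0_pr]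
    constructor
    · intro hα
      obtain ⟨I, u, hu, hI⟩ := isOpen_pi_iff.1 (hA j).isOpen α hα
      refine ⟨I.sup id + 1, fun β hβ => hI ?_⟩
      intro k hk
      have h1 : k ≤ I.sup id := Finset.le_sup (f := id) hk
      rw [hβ k (lt_of_lt_of_le (Nat.lt_succ_of_le h1) (le_pr_right _ _))]
      exact (hu k hk).2
    · rintro ⟨n, hn⟩
      exact hn α fun _ _ => rfl

theorem RowUniversal.coordUniversal_rhoZero (h : RowUniversal σ ξ) :
    CoordUniversal (rhoZero ∘ σ) ξ := by
  intro B hB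
  obtain ⟨g, hg, hg'⟩ := h _ hB
  refine ⟨g, hg, fun α j => ?_⟩
  have := hg' α j
  rw [Function.comp_apply, rhoZero_eq_true, ← not_iff_not, ← Set.mem_compl_iff, this]
  simp

/-- A `Σ⁰_ξ` set is a countable union of `Π⁰_ζ` sets, where `ζ < ξ`; here `1 < ξ`. -/
theorem SigmaZero.exists_iUnion {A : Set Cantor} (h : SigmaZero ξ A) (hξ : 1 < ξ) :
    ∃ (ζ : ℕ → Ordinal.{0}) (B : ℕ → Set Cantor), (∀ n, ζ n < ξ) ∧
      (∀ n, SigmaZero (ζ n) (B n)ᶜ) ∧ A = ⋃ n, B n := by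
  rcases h.cases_on with h | ⟨-, ζ, B, -, h2, h3, rfl⟩
  · exact absurd h.1 hξ.ne'
  · exact ⟨ζ, fun n => (B n)ᶜ, h2, by simpa using h3, rfl⟩

/-- If the coordinates of `σ` are universal for classes `Π⁰_{κ_m}` such that each `ζ < ξ` is
eventually at most `κ_m`, then the rows of `σ` are universal for the class `Σ⁰_ξ`. -/
theorem rowUniversal_of_coord (κ : ℕ → Ordinal.{0}) (hξ : 1 < ξ) (h1 : ∀ m, 1 ≤ κ m)
    (hκ : ∀ ζ < ξ, ∃ M, ∀ m, M ≤ m → ζ ≤ κ m)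
    (h : ∀ B : ℕ → Set Cantor, (∀ m, SigmaZero (κ m) (B m)ᶜ) →
      ∃ g, StrictlyCausal g ∧ ∀ α m, σ (g α) m = true ↔ α ∈ B m) : RowUniversal σ ξ := by
  classical
  intro A hA
  choose ζ B h2 h3 h4 using fun j => (hA j).exists_iUnion hξ
  -- The set `B j a` appears in the row `j` as soon as its class is small enough.
  let D : ℕ → Set Cantor := fun m =>
    if ζ (pr0 m) (pr0 (pr1 m)) ≤ κ m then B (pr0 m) (pr0 (pr1 m)) else ∅
  obtain ⟨g, hg, hg'⟩ := h D fun m => by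
    by_cases hm : ζ (pr0 m) (pr0 (pr1 m)) ≤ κ m
    · simp only [D, if_pos hm]
      exact (h3 _ _).mono hm
    · simp only [D, if_neg hm, Set.compl_empty]
      exact .univ (h1 m)
  refine ⟨g, hg, fun α j => ?_⟩
  simp only [hg']
  rw [h4 j, Set.mem_iUnion]
  constructor
  · rintro ⟨a, ha⟩
    obtain ⟨M, hM⟩ := hκ _ (h2 j a)
    refine ⟨pr a M, ?_⟩
    have : ζ j a ≤ κ (pr j (pr a M)) :=
      hM _ ((le_pr_right a M).trans (le_pr_right j _))
    simpa [D, this] using ha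
  · rintro ⟨n, hn⟩
    simp only [D, pr0_pr, pr1_pr] at hn
    split_ifs at hn
    · exact ⟨_, hn⟩
    · exact absurd hn (Set.notMem_empty _)

theorem CoordUniversal.rowUniversal (h : CoordUniversal σ ξ) (hξ : 1 ≤ ξ) :
    RowUniversal σ (ξ + 1) :=
  rowUniversal_of_coord (fun _ => ξ) (hξ.trans_lt (lt_add_one _)) (fun _ => hξ)
    (fun _ hζ => ⟨0, fun _ _ => Order.le_of_lt_add_one hζ⟩) h

theorem CoordUniversal.shift (h : CoordUniversal σ ξ) : CoordUniversal (shift ∘ σ) ξ := by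
  intro B hB
  obtain ⟨g, hg, hg'⟩ := h (fun j => B (j - 1)) fun j => hB _
  exact ⟨g, hg, fun α j => hg' α (j + 1)⟩

/-- Composition with `ρ_0^η` raises universality by `η`. At a limit `η`, the coordinate `m` of `ρ_0^η` is
the coordinate `0` of `ρ_0^{θ_m} ∘ σ_m`, where `σ_m` accounts for the finitely many ordinals
`θ_0, …, θ_{m-1}`; so the induction hypothesis applies to each coordinate. -/
theorem RowUniversal.rho (hθ : IsLimitChoice θ) (hη : η < ω₁) (hξ : 1 ≤ ξ)
    (hi : IndepCoords σ) (h : RowUniversal σ ξ) :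
    RowUniversal (rho θ η ∘ σ) (ξ + η) ∧
      ∀ ζ, η = ζ + 1 → CoordUniversal (PotWadge.rho θ η ∘ σ) (ξ + ζ) := by
  induction η using WellFoundedLT.induction generalizing σ ξ with
  | _ η ih =>
  rcases eq_zero_or_add_one_or_isSuccLimit η with rfl | ⟨ζ, rfl⟩ | hl
  · refine ⟨by simpa [rho_zero] using h, fun ζ hζ => ?_⟩
    exact absurd hζ.symm (by simp)
  · have h1 := (ih ζ (lt_add_one _) ((lt_add_one _).trans hη) hξ hi h).1.coordUniversal_rhoZero
    refine ⟨?_, ?_⟩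
    · rw [rho_succ, ← add_assoc]
      exact CoordUniversal.rowUniversal h1 (hξ.trans le_self_add)
    · intro ζ' hζ'
      obtain rfl : ζ = ζ' := by simpa using hζ'
      rw [rho_succ]
      exact h1
  · obtain ⟨hθ', hlub⟩ := hθ η hl hη
    set f : ℕ → Cantor → Cantor := fun k => PotWadge.rho θ (θ η k) with hf
    choose ζ hζ using fun m => (hθ' m).2
    have hle : ∀ m, 1 ≤ ξ + partialSum (θ η) m := fun m => hξ.trans le_self_add
    have hind : ∀ m, IndepCoords (tailIter f m ∘ σ) := fun m =>
      (tailIter_indepCoords (fun k => indepCoords_rho hθ ((hθ' k).1.trans hη)) m).comp hi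
    have step : ∀ m, RowUniversal (tailIter f m ∘ σ) (ξ + partialSum (θ η) m) →
        CoordUniversal (f m ∘ tailIter f m ∘ σ) (ξ + partialSum (θ η) m + ζ m) := fun m hm =>
      (ih _ (hθ' m).1 ((hθ' m).1.trans hη) (hle m) (hind m) hm).2 _ (hζ m)
    have key : ∀ m, RowUniversal (tailIter f m ∘ σ) (ξ + partialSum (θ η) m) := by
      intro m
      induction m with
      | zero => simpa [tailIter, partialSum] using h
      | succ m ihm =>
        rw [partialSum_succ, hζ m, ← add_assoc, ← add_assoc]
        exact (step m ihm).shift.rowUniversal ((hle m).trans le_self_add)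
    refine ⟨?_, by rintro ζ rfl; exact absurd hl (by simp)⟩
    refine rowUniversal_of_coord (fun m => ξ + partialSum (θ η) m + ζ m) ?_
      (fun m => (hle m).trans le_self_add) ?_ ?_
    · exact hξ.trans_lt (lt_add_of_pos_right _ hl.bot_lt)
    · intro μ hμ
      obtain ⟨M, hM⟩ : ∃ M, μ < ξ + partialSum (θ η) M := by
        by_contra! hcon
        refine absurd hμ (not_lt.2 ((Ordinal.add_le_iff_of_isSuccLimit hl).2 fun ν hν => ?_))
        obtain ⟨_, ⟨n, rfl⟩, hn⟩ := (lt_isLUB_iff hlub).1 hν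
        exact le_trans (by gcongr) (hcon n)
      refine ⟨M, fun m hm => Order.le_of_lt_add_one ?_⟩
      rw [add_assoc, ← hζ, add_assoc, ← partialSum_succ]
      refine hM.trans_le ?_
      gcongr
      exact partialSum_mono _ (by omega)
    · -- Independence reduces simultaneous universality to that of each coordinate.
      intro B hB
      have hex : ∀ m, ∃ g, StrictlyCausal g ∧
          ∀ α, PotWadge.rho θ η (σ (g α)) m = true ↔ α ∈ B m := by
        intro m
        obtain ⟨g, hg, hg'⟩ := step m (key m) (fun _ => B m) fun _ => hB m
        refine ⟨g, hg, fun α => ?_⟩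
        rw [rho_limit_apply hl fun k => (hθ' k).1]
        exact hg' α 0
      choose g hg hg' using hex
      obtain ⟨π, -, hπ⟩ := (indepCoords_rho hθ hη).comp hi
      refine ⟨fun α k => g (π k) α k, fun n α β hαβ => hg _ n α β hαβ, fun α m => ?_⟩
      rw [← hg' m α]
      have := hπ m (fun k => g (π k) α k) (g m α) fun k hk => by simp only [hk]
      rw [this]
      rfl

theorem rowUniversal_rho (hθ : IsLimitChoice θ) (h1 : 1 ≤ ξ) (hξ : ξ < ω₁) :
    RowUniversal (PotWadge.rho θ (ξ - 1)) ξ := by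
  have := (rowUniversal_id.rho hθ ((Ordinal.sub_le_self ξ 1).trans_lt hξ) le_rfl
    indepCoords_id).1
  rwa [add_sub_of_one_le h1, Function.comp_id] at this

/-- Otherwise, a strictly causal map would reduce the complement of `C_ξ` to `C_ξ`; a fixed point of this
map would be in both sets or in none. -/
theorem not_piZero_CSet (hθ : IsLimitChoice θ) (h1 : 1 ≤ ξ) (hξ : ξ < ω₁) :
    ¬ PiZero ξ (CSet θ ξ) := by
  intro h
  obtain ⟨g, hg, hg'⟩ := rowUniversal_rho hθ h1 hξ (fun _ => (CSet θ ξ)ᶜ) fun _ => h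
  obtain ⟨α, hα⟩ := hg.exists_fixedPoint
  have hiff : α ∈ (CSet θ ξ)ᶜ ↔ α ∈ CSet θ ξ := by
    have h2 : ∀ j, α ∈ (CSet θ ξ)ᶜ ↔ ∃ n, PotWadge.rho θ (ξ - 1) α (pr j n) = true := by
      intro j
      have := hg' α j
      rwa [hα] at this
    rw [mem_CSet]
    constructor
    · intro h
      obtain ⟨n, hn⟩ := (h2 0).1 h
      exact ⟨_, hn⟩
    · rintro ⟨m, hm⟩
      rw [h2 (pr0 m)]
      exact ⟨pr1 m, by rwa [pr_pr0_pr1]⟩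
  exact (iff_not_self hiff.symm).elim

/-- The sets `C_ξ^0`, `C_ξ^1` are not separable by a `Δ⁰_ξ` set `D`: otherwise a strictly causal map
would send `D` into `C_ξ^1` and its complement into `C_ξ^0`, and could not have a fixed point. -/
theorem not_deltaZero_separates (hθ : IsLimitChoice θ) (h1 : 1 ≤ ξ) (hξ : ξ < ω₁)
    {D : Set Cantor} (hD : DeltaZero ξ D) (h0 : CSetPar θ ξ 0 ⊆ D) :
    ¬ Disjoint D (CSetPar θ ξ 1) := by
  intro hdis
  obtain ⟨g, hg, hg'⟩ := rowUniversal_rho hθ h1 hξ (fun j => if j % 2 = 0 then Dᶜ else D)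
    fun j => by
      split_ifs
      · exact hD.2
      · exact hD.1
  obtain ⟨α, hα⟩ := hg.exists_fixedPoint
  have h2 : ∀ j, α ∈ (if j % 2 = 0 then Dᶜ else D) ↔
      ∃ n, PotWadge.rho θ (ξ - 1) α (pr j n) = true := by
    intro j
    have := hg' α j
    rwa [hα] at this
  have hpar : ∀ m, PotWadge.rho θ (ξ - 1) α m = true →
      α ∈ (if pr0 m % 2 = 0 then Dᶜ else D) := fun m hm =>
    (h2 (pr0 m)).2 ⟨pr1 m, by rwa [pr_pr0_pr1]⟩
  have hfirst : ∀ m, PotWadge.rho θ (ξ - 1) α m = true → ∃ m, PotWadge.rho θ (ξ - 1) α m = true ∧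
      ∀ l < m, PotWadge.rho θ (ξ - 1) α l = false := by
    intro m hm
    have hex : ∃ m, PotWadge.rho θ (ξ - 1) α m = true := ⟨m, hm⟩
    classical
    exact ⟨Nat.find hex, Nat.find_spec hex, fun l hl => by simpa using Nat.find_min hex hl⟩
  by_cases hαD : α ∈ D
  · obtain ⟨n, hn⟩ := (h2 1).1 (by simpa using hαD)
    obtain ⟨m, hm, hm'⟩ := hfirst _ hn
    refine Set.disjoint_left.1 hdis hαD ⟨m, hm, hm', ?_⟩
    have := hpar m hm
    split_ifs at this with h
    · exact absurd hαD this
    · simpa using h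
  · obtain ⟨n, hn⟩ := (h2 0).1 (by simpa using hαD)
    obtain ⟨m, hm, hm'⟩ := hfirst _ hn
    refine hαD (h0 ⟨m, hm, hm', ?_⟩)
    have := hpar m hm
    split_ifs at this with h
    · simpa using h
    · exact absurd this hαD

/-! ### The enumeration of finite sequences -/

theorem shortlex_succ (k n : ℕ) : shortlex k (n + 1) = shortlex k (n / k) ++ [n % k] := by
  rw [shortlex]

theorem length_shortlex_le (k n : ℕ) : (shortlex k n).length ≤ n := by
  induction n using Nat.strong_induction_on with
  | _ n ih =>
  cases n with
  | zero => simp [shortlex]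
  | succ n =>
    have h1 := Nat.div_le_self n k
    have := ih (n / k) (by omega)
    simp only [shortlex_succ, List.length_append, List.length_singleton]
    omega

theorem exists_shortlex_eq (k : ℕ) (s : List ℕ) (hs : ∀ a ∈ s, a < k) :
    ∃ n, shortlex k n = s := by
  induction s using List.reverseRecOn with
  | nil => exact ⟨0, by simp [shortlex]⟩
  | append_singleton s a ih =>
    obtain ⟨m, hm⟩ := ih fun b hb => hs b (by simp [hb])
    have ha : a < k := hs a (by simp)
    refine ⟨a + k * m + 1, ?_⟩
    rw [shortlex_succ, Nat.add_mul_div_left _ _ (by omega), Nat.div_eq_of_lt ha, zero_add, hm,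
      Nat.add_mul_mod_self_left, Nat.mod_eq_of_lt ha]

theorem primeCode_append_singleton (s : List ℕ) (a : ℕ) :
    primeCode (s ++ [a]) = primeCode s * Nat.nth Nat.Prime s.length ^ (a + 1) := by
  have h : ∀ s : List ℕ, primeCode s =
      ∏ j ∈ Finset.range s.length, Nat.nth Nat.Prime j ^ (s.getD j 0 + 1) := by
    intro s
    rw [Finset.prod_range, primeCode]
    refine Finset.prod_congr rfl fun j _ => ?_
    simp
  rw [h, h, List.length_append, List.length_singleton, Finset.prod_range_succ]
  congr 1
  · refine Finset.prod_congr rfl fun j hj => ?_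
    rw [Finset.mem_range] at hj
    rw [List.getD_append _ _ _ _ hj]
  · simp

theorem prime_nth (j : ℕ) : (Nat.nth Nat.Prime j).Prime :=
  Nat.nth_mem_of_infinite Nat.infinite_setOfPred_prime j

theorem primeCode_pos (s : List ℕ) : 0 < primeCode s :=
  Finset.prod_pos fun _ _ => pow_pos (prime_nth _).pos _

theorem factorization_primeCode (s : List ℕ) (j : ℕ) :
    (primeCode s).factorization (Nat.nth Nat.Prime j) =
      if j < s.length then s.getD j 0 + 1 else 0 := by
  induction s using List.reverseRecOn with
  | nil => simp [primeCode]
  | append_singleton s a ih =>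
    rw [primeCode_append_singleton, Nat.factorization_mul (primeCode_pos s).ne'
      (pow_pos (prime_nth _).pos _).ne', Finsupp.add_apply, ih, (prime_nth _).factorization_pow,
      Finsupp.single_apply, List.length_append, List.length_singleton]
    simp only [(Nat.nth_injective Nat.infinite_setOfPred_prime).eq_iff]
    rcases lt_trichotomy j s.length with h | rfl | h
    · rw [if_pos h, if_neg h.ne', if_pos (by omega), List.getD_append _ _ _ _ h, add_zero]
    · simp
    · rw [if_neg (by omega), if_neg (by omega), if_neg (by omega), add_zero]

theorem primeCode_injective : Function.Injective primeCode := by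
  intro s t h
  have key : ∀ j, (if j < s.length then s.getD j 0 + 1 else 0) =
      if j < t.length then t.getD j 0 + 1 else 0 := fun j => by
    rw [← factorization_primeCode, ← factorization_primeCode, h]
  have hl : s.length = t.length := by
    rcases lt_trichotomy s.length t.length with hlt | heq | hlt
    · have := key s.length
      simp [hlt] at this
    · exact heq
    · have := key t.length
      simp [hlt] at this
  refine List.ext_getElem hl fun j h1 h2 => ?_
  have := key j
  rw [if_pos h1, if_pos h2, List.getD_eq_getElem _ _ h1, List.getD_eq_getElem _ _ h2] at this
  omega

theorem primeCode_range_infinite : (Set.range primeCode).Infinite :=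
  Set.infinite_range_of_injective primeCode_injective

theorem primeCode_primeEnum (n : ℕ) :
    primeCode (primeEnum n) = Nat.nth (fun c => c ∈ Set.range primeCode) n :=
  Function.invFun_eq (Nat.nth_mem_of_infinite (p := fun c => c ∈ Set.range primeCode)
    primeCode_range_infinite n)

theorem exists_primeEnum_eq (s : List ℕ) : ∃ n, primeEnum n = s := by
  classical
  refine ⟨Nat.count (fun c => c ∈ Set.range primeCode) (primeCode s), primeCode_injective ?_⟩
  rw [primeCode_primeEnum]
  exact Nat.nth_count (p := fun c => c ∈ Set.range primeCode) ⟨s, rfl⟩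

theorem length_primeEnum_le (n : ℕ) : (primeEnum n).length ≤ n := by
  have key : ∀ (s : List ℕ) (n : ℕ), primeEnum n = s → s.length ≤ n := by
    intro s
    induction s using List.reverseRecOn with
    | nil => intro n _; exact Nat.zero_le _
    | append_singleton s a ih =>
      intro n hn
      obtain ⟨m, hm⟩ := exists_primeEnum_eq s
      have h1 := ih m hm
      have h2 : primeCode (primeEnum m) < primeCode (primeEnum n) := by
        rw [hm, hn, primeCode_append_singleton]
        exact lt_mul_of_one_lt_right (primeCode_pos s)
          (Nat.one_lt_pow (Nat.succ_ne_zero a) (prime_nth _).one_lt)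
      rw [primeCode_primeEnum, primeCode_primeEnum] at h2
      have h3 : m < n := (Nat.nth_lt_nth (p := fun c => c ∈ Set.range primeCode)
        primeCode_range_infinite).1 h2
      simp only [List.length_append, List.length_singleton]
      omega
  exact key _ n rfl

section

variable {d : ℕ∞} [hd : Fact (2 ≤ d)]

theorem toDig_val (a : Dig d) : toDig (d := d) (a : ℕ) = a := by
  unfold toDig
  rw [dif_pos a.2]

variable (d) in
theorem length_finSeq_le (n : ℕ) : (finSeq d n).length ≤ n := by
  unfold finSeq
  rw [List.length_map]
  split_ifs
  · exact length_primeEnum_le n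
  · exact length_shortlex_le _ n

theorem exists_finSeq_eq (t : List (Dig d)) : ∃ n, finSeq d n = t := by
  have h : (t.map Subtype.val).map (toDig (d := d)) = t := by
    rw [List.map_map]
    exact (List.map_congr_left fun a _ => toDig_val a).trans (List.map_id t)
  by_cases hd' : d = ⊤
  · obtain ⟨n, hn⟩ := exists_primeEnum_eq (t.map Subtype.val)
    exact ⟨n, by rw [finSeq, if_pos hd', hn, h]⟩
  · obtain ⟨n, hn⟩ := exists_shortlex_eq d.toNat (t.map Subtype.val) fun a ha => by
      obtain ⟨b, -, rfl⟩ := List.mem_map.1 ha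
      exact Nat.cast_lt.1 (b.2.trans_eq (ENat.natCast_toNat hd').symm)
    exact ⟨n, by rw [finSeq, if_neg hd', hn, h]⟩

/-! ### The frames `s_l^i` -/

variable (d) in
theorem frame_zero (i : Dig d) : frame d 0 i = [] := by
  rw [frame]

variable (d) in
theorem frame_succ (l : ℕ) (i : Dig d) :
    frame d (l + 1) i =
    frame d (pr0 (pr1 (pr1 l))) i ++ i :: (finSeq d (pr1 (pr1 (pr1 l))) ++
      List.replicate (l - pr0 (pr1 (pr1 l)) - (finSeq d (pr1 (pr1 (pr1 l)))).length) dig0) := by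
  rw [frame]

theorem pr0_add_pr1_le (l : ℕ) : pr0 l + pr1 l ≤ l := by
  have h := le_tri (pr0 l + pr1 l)
  have h2 := pr_pr0_pr1 l
  unfold pr at h2
  omega

variable (d) in
@[simp] theorem length_frame (l : ℕ) (i : Dig d) : (frame d l i).length = l := by
  induction l using Nat.strong_induction_on with
  | _ l ih =>
  cases l with
  | zero => rw [frame_zero, List.length_nil]
  | succ l =>
    have h1 := pr0_add_pr1_le (pr1 (pr1 l))
    have h2 := (pr1_le (pr1 l)).trans (pr1_le l)
    have h3 := length_finSeq_le d (pr1 (pr1 (pr1 l)))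
    rw [frame_succ, List.length_append, ih _ (by omega)]
    simp only [List.length_cons, List.length_append, List.length_replicate]
    omega

variable (d) in
theorem exists_frame_succ_eq (l : ℕ) : ∃ (q : ℕ) (t : List (Dig d)),
    q + t.length = l ∧ ∀ i, frame d (l + 1) i = frame d q i ++ i :: t := by
  refine ⟨_, _, ?_, frame_succ d l⟩
  have := length_frame d (l + 1) dig0
  rw [frame_succ, List.length_append, length_frame, List.length_cons] at this
  omega

/-- Every node `s_q^i i t` is completed by zeros into a frame, whose index `l` has any prescribed first
component. -/
theorem exists_frame_extending (p q : ℕ) (t : List (Dig d)) : ∃ l N, pr0 l = p ∧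
    ∀ i, frame d (l + 1) i = frame d q i ++ i :: (t ++ List.replicate N dig0) := by
  obtain ⟨n, rfl⟩ := exists_finSeq_eq t
  refine ⟨pr p (pr 0 (pr q n)), pr p (pr 0 (pr q n)) - q - (finSeq d n).length, pr0_pr _ _,
    fun i => ?_⟩
  rw [frame_succ]
  simp only [pr1_pr, pr0_pr]

/-! ### Levels of the tree -/

variable (d) in
/-- A family of functions into the sequences of length `l`, which contains the level `l` of `T_d`: an
element has the extensions by a constant, and the frame `s_l` has moreover the extension by
`(i)_{i ∈ d}`. Compared with `T_d`, the bound on the coordinate `0` is dropped, and the empty sequence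
also has extensions by constants. -/
inductive FrameNode : ℕ → (Dig d → List (Dig d)) → Prop
  | nil : FrameNode 0 fun _ => []
  | const (l : ℕ) (x : Dig d → List (Dig d)) (m : Dig d) :
      FrameNode l x → FrameNode (l + 1) fun i => x i ++ [m]
  | split (l : ℕ) : FrameNode (l + 1) fun i => frame d l i ++ [i]

theorem FrameNode.node (q : ℕ) (t : List (Dig d)) :
    FrameNode d (q + t.length + 1) fun i => frame d q i ++ i :: t := by
  induction t using List.reverseRecOn with
  | nil => exact .split q
  | append_singleton t m ih =>
    have := FrameNode.const _ _ m ih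
    simpa [add_assoc] using this

theorem FrameNode.frame (l : ℕ) : FrameNode d l (frame d l) := by
  cases l with
  | zero =>
    have : PotWadge.frame d 0 = fun _ => [] := funext (frame_zero d)
    rw [this]
    exact .nil
  | succ l =>
    obtain ⟨q, t, h, h'⟩ := exists_frame_succ_eq d l
    rw [funext h', ← h]
    exact .node q t

theorem FrameNode.of_mem_frameTree {s : List (Dig d → Dig d)} (hs : s ∈ frameTree d) :
    FrameNode d s.length fun i => s.map fun v => v i := by
  rcases hs with rfl | ⟨l, t, h, -⟩
  · exact .nil
  · have hl : s.length = l + t.length + 1 := by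
      have := congrArg List.length (h dig0)
      rw [List.length_map, List.length_append, length_frame, List.length_cons] at this
      omega
    rw [hl, funext h]
    exact .node l t

theorem FrameNode.of_mem_level {l : ℕ} {x : Dig d → List (Dig d)} (hx : x ∈ level (frameTree d) l) :
    FrameNode d l x := by
  obtain ⟨s, hs, rfl, rfl⟩ := hx
  exact .of_mem_frameTree hs

/-- At each place, the digits of a node are either constant, or `(i)_{i ∈ d}`. -/
theorem FrameNode.getElem? {l : ℕ} {x : Dig d → List (Dig d)} (hx : FrameNode d l x) {n : ℕ}
    (hn : n < l) : (∃ c, ∀ i, (x i)[n]? = some c) ∨ ∀ i, (x i)[n]? = some i := by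
  have hlen : ∀ {l x}, FrameNode d l x → ∀ i, (x i).length = l := by
    intro l x hx i
    induction hx with
    | nil => rfl
    | const l x m _ ih => rw [List.length_append, ih, List.length_singleton]
    | split l => rw [List.length_append, length_frame, List.length_singleton]
  induction l generalizing x with
  | zero => omega
  | succ l ih =>
    rcases Nat.lt_succ_iff_lt_or_eq.1 hn with h | rfl
    · cases hx with
      | const _ y m hy =>
        simp only [fun i => List.getElem?_append_left (l₂ := [m]) (h.trans_eq (hlen hy i).symm)]
        exact ih hy h
      | split =>
        simp only [fun i => List.getElem?_append_left (l₂ := [i])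
          (h.trans_eq (length_frame d l i).symm)]
        exact ih (.frame l) h
    · cases hx with
      | const _ y m hy =>
        refine Or.inl ⟨m, fun i => ?_⟩
        rw [List.getElem?_append_right (hlen hy i).le, hlen hy i]
        simp
      | split =>
        refine Or.inr fun i => ?_
        rw [List.getElem?_append_right (length_frame d n i).le, length_frame]
        simp

/-- One-sidedness: the last digits of two nodes in the coordinates `i ≠ j` agree only if both nodes split
at the last level, or none of them does. -/
theorem FrameNode.eq_of_common {l : ℕ} {x y : Dig d → List (Dig d)} (hx : FrameNode d l x)
    (hy : FrameNode d l y) {i j : Dig d} (hij : i ≠ j) (hi : x i = y i) (hj : x j = y j) :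
    x = y := by
  induction l generalizing x y with
  | zero =>
    cases hx
    cases hy
    rfl
  | succ l ih =>
    have hmix : ∀ (z : Dig d → List (Dig d)) (m : Dig d), z i ++ [m] = PotWadge.frame d l i ++ [i] →
        z j ++ [m] = PotWadge.frame d l j ++ [j] → False := by
      intro z m h1 h2
      have h1 := (List.append_inj' h1 rfl).2
      have h2 := (List.append_inj' h2 rfl).2
      simp only [List.cons.injEq, and_true] at h1 h2
      exact hij (h1.symm.trans h2)
    cases hx with
    | const _ x m hx =>
      cases hy with
      | const _ y m' hy =>
        have h1 := List.append_inj' hi rfl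
        have h2 := List.append_inj' hj rfl
        obtain rfl : m = m' := by simpa using h1.2
        rw [ih hx hy h1.1 h2.1]
      | split => exact (hmix x m hi hj).elim
    | split =>
      cases hy with
      | const _ y m' hy => exact (hmix y m' hi.symm hj.symm).elim
      | split => rfl

theorem oneSided_level (l : ℕ) : OneSided (level (frameTree d) l) := by
  intro x hx y hy hxy i j hij
  by_contra! h
  exact hxy ((FrameNode.of_mem_level hx).eq_of_common (.of_mem_level hy) hij h.1 h.2)

/-- A cycle of nodes, written as a periodic sequence, has three vertices with a common coordinate.  If
it avoids the splitting node `(s_l^i i)_{i ∈ d}`, then all its vertices have the same last digit, and it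
comes from a cycle of the level below.  Otherwise both neighbours of the splitting node have the same
last digit `m`, and they share with it the coordinate `m`. -/
theorem FrameNode.exists_common_of_cycle (l L : ℕ) (hL : 3 ≤ L) (v : ℕ → Dig d → List (Dig d))
    (hv : ∀ n, FrameNode d l (v n)) (hper : ∀ n, v (n + L) = v n)
    (hinj : ∀ a b, v a = v b → a ≡ b [MOD L]) (hadj : ∀ n, ∃ i, v n i = v (n + 1) i) :
    ∃ i a b c, ¬ a ≡ b [MOD L] ∧ ¬ b ≡ c [MOD L] ∧ ¬ a ≡ c [MOD L] ∧
      v a i = v b i ∧ v b i = v c i := by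
  induction l generalizing v with
  | zero =>
    have h : ∀ n, v n = fun _ => [] := fun n => by
      have := hv n
      generalize v n = x at this
      cases this
      rfl
    have := hinj 0 1 (by rw [h, h])
    rw [Nat.ModEq, Nat.mod_eq_of_lt (by omega), Nat.mod_eq_of_lt (by omega)] at this
    omega
  | succ l ih =>
    have hcases : ∀ n, v n ≠ (fun i => PotWadge.frame d l i ++ [i]) →
        ∃ x m, FrameNode d l x ∧ v n = fun i => x i ++ [m] := by
      intro n hn
      have := hv n
      generalize v n = y at this hn
      cases this with
      | const _ x m hx => exact ⟨x, m, hx, rfl⟩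
      | split => exact absurd rfl hn
    by_cases hsp : ∃ j, v j = fun i => PotWadge.frame d l i ++ [i]
    · obtain ⟨j, hj⟩ := hsp
      have hne : ∀ n, ∃ (x : Dig d → List (Dig d)) (m : Dig d),
          0 < n → n < L → v (j + n) = fun i => x i ++ [m] := by
        intro n
        by_cases hn : 0 < n ∧ n < L
        · obtain ⟨x, m, -, h⟩ := hcases (j + n) fun h => by
            have h1 : j + n ≡ j + 0 [MOD L] := hinj _ _ (h.trans hj.symm)
            have h2 := Nat.ModEq.add_left_cancel' j h1
            rw [Nat.ModEq, Nat.mod_eq_of_lt hn.2, Nat.zero_mod] at h2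
            omega
          exact ⟨x, m, fun _ _ => h⟩
        · exact ⟨fun _ => [], dig0, fun h1 h2 => absurd ⟨h1, h2⟩ hn⟩
      choose x m hxm using hne
      have hm : ∀ n, n + 1 < L → m (n + 1) = m 1 := by
        intro n
        induction n with
        | zero => intro _; rfl
        | succ n ihn =>
          intro hn
          obtain ⟨i, hi⟩ := hadj (j + (n + 1))
          rw [hxm (n + 1) (by omega) (by omega), add_assoc, hxm _ (by omega) hn] at hi
          have := (List.append_inj' hi rfl).2
          simp only [List.cons.injEq, and_true] at this
          rw [← this, ihn (by omega)]
      have h1 : v j (m 1) = v (j + 1) (m 1) := by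
        obtain ⟨i, hi⟩ := hadj j
        have hi' := hi
        rw [hj, hxm 1 (by omega) (by omega)] at hi'
        have := (List.append_inj' hi' rfl).2
        simp only [List.cons.injEq, and_true] at this
        rwa [← this]
      have h2 : v (j + (L - 1)) (m 1) = v j (m 1) := by
        obtain ⟨i, hi⟩ := hadj (j + (L - 1))
        rw [add_assoc, Nat.sub_add_cancel (by omega), hper] at hi
        have hi' := hi
        rw [hj, hxm (L - 1) (by omega) (by omega)] at hi'
        have := (List.append_inj' hi' rfl).2
        simp only [List.cons.injEq, and_true] at this
        have h3 := hm (L - 2) (by omega)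
        rw [show L - 2 + 1 = L - 1 by omega] at h3
        rwa [← h3, this]
      have hmod : ∀ a b, a < L → b < L → a ≠ b → ¬ j + a ≡ j + b [MOD L] := by
        intro a b ha hb hab h
        have := Nat.ModEq.add_left_cancel' j h
        rw [Nat.ModEq, Nat.mod_eq_of_lt ha, Nat.mod_eq_of_lt hb] at this
        exact hab this
      exact ⟨m 1, j + (L - 1), j + 0, j + 1, hmod _ _ (by omega) (by omega) (by omega),
        hmod _ _ (by omega) (by omega) (by omega), hmod _ _ (by omega) (by omega) (by omega), h2, h1⟩
    · push Not at hsp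
      choose x m hx hxm using fun n => hcases n (hsp n)
      have hm : ∀ n, m n = m 0 := by
        intro n
        induction n with
        | zero => rfl
        | succ n ihn =>
          obtain ⟨i, hi⟩ := hadj n
          rw [hxm n, hxm (n + 1)] at hi
          have := (List.append_inj' hi rfl).2
          simp only [List.cons.injEq, and_true] at this
          rw [← this, ihn]
      have hiff : ∀ a b i, v a i = v b i ↔ x a i = x b i := by
        intro a b i
        rw [hxm a, hxm b, hm a, hm b]
        simp
      obtain ⟨i, a, b, c, h1, h2, h3, h4, h5⟩ := ih x hx
        (fun n => funext fun i => (hiff _ _ i).1 (congrFun (hper n) i))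
        (fun a b h => hinj a b (funext fun i => (hiff _ _ i).2 (congrFun h i)))
        (fun n => (hadj n).imp fun i hi => (hiff _ _ i).1 hi)
      exact ⟨i, a, b, c, h1, h2, h3, (hiff _ _ i).2 h4, (hiff _ _ i).2 h5⟩

theorem almostAcyclic_level (l : ℕ) : AlmostAcyclic (level (frameTree d) l) := by
  intro v w hw
  have hL := hw.three_le_length
  set L := w.length with hLdef
  have hL0 : 0 < L := by omega
  have hlt : ∀ n, n % L < L := fun n => Nat.mod_lt _ hL0
  obtain ⟨i, a, b, c, h1, h2, h3, h4, h5⟩ := FrameNode.exists_common_of_cycle l L hL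
    (fun n => (w.getVert (n % L)).1) (fun n => .of_mem_level (w.getVert (n % L)).2)
    (fun n => by simp)
    (fun a b h => by
      refine hw.getVert_injOn' ?_ ?_ (Subtype.ext h)
      · have := hlt a
        simp only [Set.mem_ofPred_eq]
        omega
      · have := hlt b
        simp only [Set.mem_ofPred_eq]
        omega)
    (fun n => by
      obtain ⟨-, i, hi⟩ := w.adj_getVert_succ (hlt n)
      refine ⟨i, ?_⟩
      rw [hi]
      rcases Nat.lt_or_ge (n % L + 1) L with h | h
      · rw [← Nat.mod_add_mod, Nat.mod_eq_of_lt h]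
      · have h' : n % L + 1 = L := le_antisymm (hlt n) h
        rw [← Nat.mod_add_mod, h', Nat.mod_self, hLdef, w.getVert_length, w.getVert_zero])
  simp only [Nat.ModEq] at h1 h2 h3
  refine ⟨i, ?_⟩
  have ha := hlt a
  have hb := hlt b
  have hc := hlt c
  rcases Nat.lt_or_gt_of_ne h1 with h1 | h1 <;> rcases Nat.lt_or_gt_of_ne h2 with h2 | h2
  · exact ⟨_, _, _, h1, h2, hc, h4, h5⟩
  · rcases Nat.lt_or_gt_of_ne h3 with h3 | h3
    · exact ⟨_, _, _, h3, h2, hb, h4.trans h5, h5.symm⟩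
    · exact ⟨_, _, _, h3, h1, hb, (h4.trans h5).symm, h4⟩
  · rcases Nat.lt_or_gt_of_ne h3 with h3 | h3
    · exact ⟨_, _, _, h1, h3, hc, h4.symm, h4.trans h5⟩
    · exact ⟨_, _, _, h2, h3, ha, h5, (h4.trans h5).symm⟩
  · exact ⟨_, _, _, h2, h1, ha, h5.symm, h4.symm⟩

variable (d) in
theorem frameTree_mem_tree : frameTree d ∈ Descriptive.tree (Dig d → Dig d) := by
  rintro s v (h | ⟨l, t, h, hb⟩)
  · simp at h
  have hb' : ∀ (n : ℕ) (hn : n < s.length), (s[n] dig0 : ℕ) ≤ n := by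
    intro n hn
    have := hb n (by rw [List.length_append]; omega)
    rwa [List.getElem_append_left hn] at this
  have hmap : ∀ i, s.map (fun v => v i) ++ [v i] = frame d l i ++ i :: t := fun i => by
    rw [← h i, List.map_append]
    rfl
  rcases List.eq_nil_or_concat t with rfl | ⟨t, m, rfl⟩
  · have hs : ∀ i, s.map (fun v => v i) = frame d l i := fun i =>
      (List.append_inj' (hmap i) rfl).1
    cases l with
    | zero =>
      left
      have := hs dig0
      rwa [frame_zero, List.map_eq_nil_iff] at this
    | succ l =>
      obtain ⟨q, t, -, h'⟩ := exists_frame_succ_eq d l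
      exact Or.inr ⟨q, t, fun i => by rw [hs, h'], hb'⟩
  · refine Or.inr ⟨l, t, fun i => ?_, hb'⟩
    have h1 : s.map (fun v => v i) ++ [v i] = (frame d l i ++ i :: t) ++ [m] := by
      rw [hmap i]
      simp
    exact (List.append_inj' h1 rfl).1

theorem finite_level (l : ℕ) : (level (frameTree d) l).Finite := by
  induction l with
  | zero =>
    refine (Set.finite_singleton fun _ => []).subset ?_
    rintro x ⟨s, -, hs, rfl⟩
    rw [List.length_eq_zero_iff] at hs
    subst hs
    rfl
  | succ l ih =>
    have hfin : {m : Dig d | (m : ℕ) ≤ l}.Finite :=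
      (Set.finite_Iic l).preimage Subtype.val_injective.injOn
    refine ((ih.image2 (fun x m i => x i ++ [m]) hfin).union
      (Set.finite_singleton fun i => frame d l i ++ [i])).subset ?_
    rintro x ⟨s, hs, hl, rfl⟩
    have hnode := FrameNode.of_mem_frameTree hs
    obtain ⟨s, v, rfl⟩ : ∃ s' v, s = s' ++ [v] := by
      rcases List.eq_nil_or_concat s with rfl | ⟨s', v, rfl⟩
      · simp at hl
      · exact ⟨s', v, by simp⟩
    have hl' : s.length = l := by simpa using hl
    rw [hl] at hnode
    generalize hx : (fun i => (s ++ [v]).map fun v => v i) = x at hnode ⊢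
    cases hnode with
    | split => exact Or.inr rfl
    | const _ y m hy =>
      have hy' : ∀ i, s.map (fun v => v i) = y i ∧ v i = m := fun i => by
        have h1 := congrFun hx i
        simp only [List.map_append, List.map_cons, List.map_nil] at h1
        have h2 := List.append_inj' h1 rfl
        simpa using h2
      refine Or.inl ⟨y, ⟨s, frameTree_mem_tree d hs, hl', (funext fun i => (hy' i).1).symm⟩, m, ?_,
        rfl⟩
      rcases hs with h | ⟨_, _, -, hb⟩
      · simp at h
      have := hb l (by omega)
      rw [List.getElem_append_right hl'.le] at this
      simpa [(hy' dig0).2] using this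

/-! ### Effectivity of the levels -/

/-- A finite set of recursive points is `Δ¹_1`: it is the set of branches of a recursive tree, and a
point is outside of it if it leaves this tree, the number `y(0)` bounding the place where it does. -/
theorem isDeltaOneOne_of_finite {l : ℕ} {A : Set (Fin l → ℕ → ℕ)} (hA : A.Finite)
    (hrec : ∀ x ∈ A, ∀ j, Primrec (x j)) : IsDeltaOneOne A := by
  classical
  have hprim : PrimrecPred fun p : List (List ℕ) × List ℕ =>
      ∃ x ∈ A, p.1 = List.ofFn fun j => (List.range p.2.length).map (x j) := by
    induction A, hA using Set.Finite.induction_on with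
    | empty =>
      exact (Primrec.eq.comp (α := List (List ℕ) × List ℕ) (Primrec.const 0)
        (Primrec.const 1)).of_eq fun _ => by simp
    | insert _ _ ih =>
      rename_i x A _ _
      have h1 : PrimrecPred fun p : List (List ℕ) × List ℕ =>
          p.1 = List.ofFn fun j => (List.range p.2.length).map (x j) := by
        refine Primrec.eq.comp Primrec.fst (Primrec.list_ofFn fun j => ?_)
        exact Primrec.list_map (Primrec.list_range.comp (Primrec.list_length.comp Primrec.snd))
          ((hrec x (Set.mem_insert _ _) j).comp Primrec.snd)
      refine (h1.or (ih fun y hy => hrec y (Set.mem_insert_of_mem _ hy))).of_eq fun p => ?_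
      simp
  have hagree : ∀ (x y : Fin l → ℕ → ℕ) (n : ℕ),
      ((List.ofFn fun j => (List.range n).map (x j)) = List.ofFn fun j => (List.range n).map (y j)) ↔
        ∀ j, ∀ k < n, x j k = y j k := by
    intro x y n
    rw [List.ofFn_inj, funext_iff]
    simp
  have hmem : ∀ x, x ∈ A ↔ ∀ n : ℕ, ∃ y ∈ A, ∀ j, ∀ k < n, x j k = y j k := by
    intro x
    refine ⟨fun hx n => ⟨x, hx, fun _ _ _ => rfl⟩, fun h => ?_⟩
    choose y hy hxy using h
    have := hA.to_subtype
    obtain ⟨z, hz⟩ := Finite.exists_infinite_fiber fun n => (⟨y n, hy n⟩ : A)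
    have hz' := (Set.infinite_coe_iff.1 hz)
    have hxz : x = z := by
      funext j k
      obtain ⟨n, hn, hkn⟩ := hz'.exists_gt k
      rw [hxy n j k hkn]
      exact congrFun (congrFun (congrArg Subtype.val hn) j) k
    rw [hxz]
    exact z.2
  constructor
  · refine ⟨_, hprim.computablePred, fun x => ?_⟩
    rw [hmem x]
    simp only [List.length_map, List.length_range, hagree, exists_const]
  · refine ⟨_, (PrimrecPred.or (p := fun p : List (List ℕ) × List ℕ => p.2.length ≤ p.2.headI)
      (Primrec.nat_le.comp (Primrec.list_length.comp Primrec.snd)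
        (Primrec.list_headI.comp Primrec.snd)) hprim.not).computablePred, fun x => ?_⟩
    rw [Set.mem_compl_iff, hmem x]
    simp only [List.length_map, List.length_range, hagree]
    constructor
    · intro h
      push Not at h
      obtain ⟨n, hn⟩ := h
      refine ⟨fun _ => n, fun k => ?_⟩
      cases k with
      | zero => exact Or.inl (Nat.zero_le _)
      | succ k =>
        rcases Nat.lt_or_ge n (k + 1) with h | h
        · right
          rintro ⟨y, hy, hxy⟩
          obtain ⟨j, i, hi, hne⟩ := hn y hy
          exact hne (hxy j i (by omega))
        · left
          rw [List.range_succ_eq_map]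
          exact h
    · rintro ⟨y, hy⟩ h
      rcases hy (y 0 + 1) with h1 | h1
      · rw [List.range_succ_eq_map] at h1
        simp at h1
      · exact h1 (h _)

variable (d) in
theorem primrecPred_lt_dig : PrimrecPred fun n : ℕ => (n : ℕ∞) < d := by
  cases d using ENat.recTopCoe with
  | top =>
    exact (Primrec.eq.comp (Primrec.const 0) (Primrec.const 0)).of_eq fun n => by simp
  | coe k =>
    exact (Primrec.nat_lt.comp Primrec.id (Primrec.const k)).of_eq fun n => by simp

theorem isDeltaOneOne_levelCode (l : ℕ) : IsDeltaOneOne (levelCode (frameTree d) l) := by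
  classical
  refine isDeltaOneOne_of_finite ?_ ?_
  · have hfin : {s | s ∈ frameTree d ∧ s.length = l}.Finite := by
      refine Set.Finite.of_finite_image (f := fun s i => s.map fun v => v i)
        ((finite_level (d := d) l).subset ?_) ?_
      · rintro _ ⟨s, ⟨hs, hl⟩, rfl⟩
        exact ⟨s, hs, hl, rfl⟩
      · rintro s ⟨-, hs⟩ t ⟨-, ht⟩ hst
        refine List.ext_getElem (hs.trans ht.symm) fun n h1 h2 => funext fun i => ?_
        have := congrArg (fun u => u[n]?) (congrFun hst i)
        simpa [h1, h2] using this
    refine (hfin.biUnion (t := fun s => {x : Fin l → ℕ → ℕ | ∃ hs : s.length = l,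
      ∀ (j : Fin l) (i : ℕ), x j i = if hi : (i : ℕ∞) < d then
        ((s[j.1]'(hs ▸ j.2)) ⟨i, hi⟩ : ℕ) else 0}) fun s _ => ?_).subset ?_
    · refine Set.Subsingleton.finite ?_
      rintro x ⟨_, hx⟩ y ⟨_, hy⟩
      funext j i
      rw [hx, hy]
    · rintro x ⟨s, hs, hl, hx⟩
      exact Set.mem_biUnion ⟨hs, hl⟩ ⟨hl, hx⟩
  · rintro x ⟨s, hs, hl, hx⟩ j
    have hj : j.1 < s.length := hl ▸ j.2
    rcases (FrameNode.of_mem_frameTree hs).getElem? hj with ⟨c, hc⟩ | hc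
    · refine (Primrec.ite (primrecPred_lt_dig d) (Primrec.const (c : ℕ)) (Primrec.const 0)).of_eq
        fun i => ?_
      rw [hx]
      split_ifs with hi
      · have := hc ⟨i, hi⟩
        simp only [List.getElem?_map, List.getElem?_eq_getElem hj, Option.map_some,
          Option.some.injEq] at this
        rw [this]
      · rfl
    · refine (Primrec.ite (primrecPred_lt_dig d) Primrec.id (Primrec.const 0)).of_eq
        fun i => ?_
      rw [hx]
      split_ifs with hi
      · have := hc ⟨i, hi⟩
        simp only [List.getElem?_map, List.getElem?_eq_getElem hj, Option.map_some,
          Option.some.injEq] at this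
        rw [this]
        rfl
      · rfl

variable (d) in
theorem isTreeWithDeltaSuitableLevels_frameTree : IsTreeWithDeltaSuitableLevels (frameTree d) :=
  ⟨frameTree_mem_tree d, fun l =>
    ⟨finite_level l, oneSided_level l, almostAcyclic_level l, isDeltaOneOne_levelCode l⟩⟩

end

/-! ### Finer Polish topologies and Baire category -/

/-- A finer Polish topology `t'` coincides with `t` on a countable intersection of dense open subsets of
the subspace `K`: its basic open sets are Borel for `t`, and thus have the Baire property in `K`. -/
theorem exists_dense_open_seq {X : Type} (t' : TopologicalSpace X)
    (ht' : @PolishSpace X t') [t : TopologicalSpace X] [PolishSpace X] (hle : t' ≤ t) (K : Set X) :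
    ∃ O : ℕ → Set K, (∀ k, IsOpen (O k)) ∧ (∀ k, Dense (O k)) ∧
      ∀ f : Cantor → K, Continuous f → (∀ α k, f α ∈ O k) →
        @Continuous Cantor X _ t' fun α => (f α : X) := by
  have hborel : @borel X t' = borel X := MeasureTheory.borel_eq_borel_of_le ht' ‹_› hle
  obtain ⟨b, hbc, -, hb⟩ := @TopologicalSpace.exists_countable_basis X t'
    (@PolishSpace.toSecondCountableTopology X t' ht')
  have hV : ∀ U ∈ b, ∃ V : Set K, IsOpen V ∧
      {y : K | (y : X) ∈ U ↔ y ∈ V} ∈ residual K := by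
    intro U hU
    have hU' : @MeasurableSet X (borel X) U := by
      rw [← hborel]
      exact MeasurableSpace.measurableSet_generateFrom
        (@TopologicalSpace.IsTopologicalBasis.isOpen X t' _ _ hb hU)
    let : MeasurableSpace X := borel X
    have : BorelSpace X := ⟨rfl⟩
    obtain ⟨V, hVo, hV⟩ := (measurable_subtype_coe (p := (· ∈ K)) hU').residualEq_isOpen
    exact ⟨V, hVo, Filter.eventuallyEq_set.1 hV⟩
  choose! V hVo hVr using hV
  have hres : {y : K | ∀ U ∈ b, (y : X) ∈ U ↔ y ∈ V U} ∈ residual K :=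
    (eventually_countable_ball (p := fun (y : K) U _ => ((y : X) ∈ U ↔ y ∈ V U)) hbc).2 hVr
  obtain ⟨S, hSo, hSd, hSc, hS⟩ := mem_residual_iff.1 hres
  obtain ⟨O, hO⟩ := (hSc.insert Set.univ).exists_eq_range (Set.insert_nonempty _ _)
  have hmem : ∀ k, O k ∈ insert Set.univ S := fun k => hO ▸ Set.mem_range_self k
  refine ⟨O, fun k => ?_, fun k => ?_, fun f hf hfO => ?_⟩
  · rcases hmem k with h | h
    · rw [h]
      exact isOpen_univ
    · exact hSo _ h
  · rcases hmem k with h | h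
    · rw [h]
      exact dense_univ
    · exact hSd _ h
  · have hfS : ∀ α, ∀ U ∈ b, (f α : X) ∈ U ↔ f α ∈ V U := by
      intro α
      refine hS (Set.mem_sInter.2 fun s hs => ?_)
      obtain ⟨k, rfl⟩ : s ∈ Set.range O := hO ▸ Set.mem_insert_of_mem _ hs
      exact hfO α k
    refine (@TopologicalSpace.IsTopologicalBasis.continuous_iff Cantor X _ t' b hb _).2
      fun U hU => ?_
    have : (fun α => (f α : X)) ⁻¹' U = f ⁻¹' V U := Set.ext fun α => hfS α U hU
    rw [this]
    exact (hVo U hU).preimage hf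

/-- `u` is an initial segment of `γ`. -/
def IsInit {A : Type} (u : List A) (γ : ℕ → A) : Prop :=
  ∀ (n : ℕ) (a : A), u[n]? = some a → γ n = a

theorem IsInit.of_append {A : Type} {u w : List A} {γ : ℕ → A} (h : IsInit (u ++ w) γ) :
    IsInit u γ := by
  intro n a ha
  have hn : n < u.length := (List.getElem?_eq_some_iff.1 ha).1
  exact h n a (by rwa [List.getElem?_append_left hn])

section

variable {d : ℕ∞} [hd : Fact (2 ≤ d)]

/-! ### Bounded sequences and nodes -/

/-- The closed subspace of `d^ω` in which the `i`-th coordinates of the branches of `T_d` live. -/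
def boundedSeqs (i : Dig d) : Set (ℕ → Dig d) := {γ | ∀ n, (γ n : ℕ) ≤ max n i}

/-- The finite sequences compatible with `boundedSeqs i`. -/
def BoundedList (i : Dig d) (u : List (Dig d)) : Prop :=
  ∀ (n : ℕ) (a : Dig d), u[n]? = some a → (a : ℕ) ≤ max n i

theorem exists_extension_into_dense {i : Dig d} {O : Set (boundedSeqs i)} (ho : IsOpen O)
    (hdense : Dense O) {u : List (Dig d)} (hu : BoundedList i u) :
    ∃ w, BoundedList i (u ++ w) ∧ ∀ γ : boundedSeqs i, IsInit (u ++ w) γ → γ ∈ O := by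
  let γ₀ : boundedSeqs i := ⟨fun n => u.getD n dig0, fun n => by
    simp only [List.getD_eq_getElem?_getD]
    cases h : u[n]? with
    | none => exact Nat.zero_le _
    | some a => exact hu n a h⟩
  have hW : IsOpen {γ : boundedSeqs i | ∀ n < u.length, γ.1 n = γ₀.1 n} := by
    have : {γ : boundedSeqs i | ∀ n < u.length, γ.1 n = γ₀.1 n} =
        ⋂ n ∈ Finset.range u.length, {γ : boundedSeqs i | γ.1 n = γ₀.1 n} := by
      ext γ
      simp
    rw [this]
    refine isOpen_biInter_finset fun n _ => ?_
    exact (isOpen_discrete ({γ₀.1 n} : Set (Dig d))).preimage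
      (f := fun γ : boundedSeqs i => γ.1 n)
      ((continuous_apply (A := fun _ : ℕ => Dig d) n).comp continuous_subtype_val)
  obtain ⟨γ₁, h1, h2⟩ := hdense.exists_mem_open hW ⟨γ₀, fun _ _ => rfl⟩
  obtain ⟨O', hO', rfl⟩ := isOpen_induced_iff.1 ho
  obtain ⟨I, v, hv, hI⟩ := isOpen_pi_iff.1 hO' γ₁.1 h1
  set M := I.sup id + 1 with hM
  have hget : ∀ n, (u ++ (List.range M).map fun k => γ₁.1 (u.length + k))[n]? =
      if n < u.length + M then some (γ₁.1 n) else none := by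
    intro n
    rcases Nat.lt_or_ge n u.length with hn | hn
    · rw [List.getElem?_append_left hn, if_pos (by omega), h2 n hn]
      simp [γ₀, hn]
    · rw [List.getElem?_append_right hn, List.getElem?_map]
      split_ifs with h
      · rw [List.getElem?_range (by omega)]
        simp only [Option.map_some, Option.some.injEq]
        rw [Nat.add_sub_cancel' hn]
      · rw [List.getElem?_eq_none (by rw [List.length_range]; omega)]
        rfl
  refine ⟨(List.range M).map fun k => γ₁.1 (u.length + k), fun n a ha => ?_, fun γ hγ => hI ?_⟩
  · rw [hget] at ha
    split_ifs at ha
    · obtain rfl : γ₁.1 n = a := by simpa using ha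
      exact γ₁.2 n
  · intro k hk
    have h3 : k ≤ I.sup id := Finset.le_sup (f := id) hk
    have h4 : γ.1 k = γ₁.1 k := hγ k _ (by rw [hget, if_pos (by omega)])
    rw [h4]
    exact (hv k hk).2

/-- The node `(s_q^i i t)_{i ∈ d}`. -/
noncomputable def node (p : ℕ × List (Dig d)) (i : Dig d) : List (Dig d) := frame d p.1 i ++ i :: p.2

theorem length_node (p : ℕ × List (Dig d)) (i : Dig d) :
    (node p i).length = p.1 + p.2.length + 1 := by
  rw [node, List.length_append, length_frame, List.length_cons, add_assoc]

theorem node_append (q : ℕ) (t w : List (Dig d)) (i : Dig d) :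
    node (q, t ++ w) i = node (q, t) i ++ w := by
  simp [node]

theorem BoundedList.node {p : ℕ × List (Dig d)} (h : BoundedList dig0 (node p dig0)) (i : Dig d) :
    BoundedList i (PotWadge.node p i) := by
  intro n a ha
  have hn : n < p.1 + p.2.length + 1 := by
    rw [← length_node p i]
    exact (List.getElem?_eq_some_iff.1 ha).1
  rcases (FrameNode.node p.1 p.2).getElem? hn with ⟨c, hc⟩ | hc
  · have h1 := h n c (hc dig0)
    have h2 : some a = some c := ha.symm.trans (hc i)
    obtain rfl : a = c := by simpa using h2
    exact h1.trans (by simp [dig0])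
  · have h2 : some a = some i := ha.symm.trans (hc i)
    obtain rfl : a = i := by simpa using h2
    exact le_max_right _ _

/-- A node has an extension by constants, all whose coordinates of index in `F` lie in given dense open
sets.  The node has to be long enough, so that the elements of `boundedSeqs i`, `i ∈ F`, satisfy beyond
it the bound required from the coordinate `0`. -/
theorem exists_node_extension (O : ∀ i : Dig d, Set (boundedSeqs i)) (ho : ∀ i, IsOpen (O i))
    (hdense : ∀ i, Dense (O i)) (q : ℕ) (t : List (Dig d))
    (hb : BoundedList dig0 (node (q, t) dig0)) (F : Finset (Dig d))
    (hF : ∀ i ∈ F, (i : ℕ) ≤ q + t.length) :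
    ∃ w, BoundedList dig0 (node (q, t ++ w) dig0) ∧
      ∀ i ∈ F, ∀ γ : boundedSeqs i, IsInit (node (q, t ++ w) i) γ → γ ∈ O i := by
  induction F using Finset.induction_on with
  | empty => exact ⟨[], by simpa using hb, by simp⟩
  | insert j F _ ih =>
    obtain ⟨w, hw, hw'⟩ := ih fun i hi => hF i (Finset.mem_insert_of_mem hi)
    obtain ⟨w', h1, h2⟩ := exists_extension_into_dense (ho j) (hdense j) (hw.node j)
    have hj := hF j (Finset.mem_insert_self _ _)
    refine ⟨w ++ w', ?_, ?_⟩
    · rw [← List.append_assoc, node_append]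
      intro n a ha
      rcases Nat.lt_or_ge n (node (q, t ++ w) dig0).length with hn | hn
      · rw [List.getElem?_append_left hn] at ha
        exact hw n a ha
      · have hn' : (node (q, t ++ w) j).length ≤ n := by
          rwa [length_node, ← length_node _ dig0]
        have hle : (j : ℕ) ≤ n := by
          rw [length_node] at hn'
          simp only [List.length_append] at hn'
          omega
        have h3 := h1 n a (by
          rw [List.getElem?_append_right hn] at ha
          rwa [List.getElem?_append_right hn', length_node, ← length_node _ dig0])
        rw [max_eq_left hle] at h3
        exact h3.trans (le_max_left _ _)
    · intro i hi γ hγ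
      rw [← List.append_assoc, node_append] at hγ
      rcases Finset.mem_insert.1 hi with rfl | hi
      · exact h2 γ hγ
      · exact hw' i hi γ hγ.of_append

theorem BoundedList.append_zeros {i : Dig d} {u : List (Dig d)} (h : BoundedList i u) (N : ℕ) :
    BoundedList i (u ++ List.replicate N dig0) := by
  intro n a ha
  rcases Nat.lt_or_ge n u.length with hn | hn
  · rw [List.getElem?_append_left hn] at ha
    exact h n a ha
  · rw [List.getElem?_append_right hn] at ha
    obtain rfl := List.eq_of_mem_replicate (List.mem_of_getElem? ha)
    exact Nat.zero_le _

/-- One step of the construction of branches: a node is extended into given dense open sets, and then by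
the digit `0`, or by the splitting `(i)_{i ∈ d}` at a level `l + 1` such that `(l)_0` is prescribed. -/
theorem exists_step (O : ∀ i : Dig d, Set (boundedSeqs i)) (ho : ∀ i, IsOpen (O i))
    (hdense : ∀ i, Dense (O i)) (k p : ℕ) (b : Bool)
    (s : {s : ℕ × List (Dig d) // BoundedList dig0 (node s dig0)}) :
    ∃ (s' : {s : ℕ × List (Dig d) // BoundedList dig0 (node s dig0)}) (w : List (Dig d)) (l : ℕ),
      (∀ i, node s'.1 i = node s.1 i ++ w ++ [if b then i else dig0]) ∧
      (∀ i : Dig d, (i : ℕ) ≤ k → (i : ℕ) ≤ s.1.1 + s.1.2.length →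
        ∀ γ : boundedSeqs i, IsInit (node s'.1 i) γ → γ ∈ O i) ∧
      (b = true → s.1.1 + s.1.2.length + w.length = l ∧ pr0 l = p) := by
  obtain ⟨⟨q, t⟩, hs⟩ := s
  have hfin : {i : Dig d | (i : ℕ) ≤ k ∧ (i : ℕ) ≤ q + t.length}.Finite :=
    ((Set.finite_Iic k).preimage Subtype.val_injective.injOn).subset fun i hi => hi.1
  obtain ⟨w, hw, hw'⟩ := exists_node_extension O ho hdense q t hs hfin.toFinset (by simp)
  have hopen : ∀ w', ∀ i : Dig d, (i : ℕ) ≤ k → (i : ℕ) ≤ q + t.length →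
      ∀ γ : boundedSeqs i, IsInit (node (q, t) i ++ w ++ w') γ → γ ∈ O i := by
    intro w' i h1 h2 γ hγ
    refine hw' i (by simp [h1, h2]) γ ?_
    rw [node_append]
    exact hγ.of_append
  cases b with
  | false =>
    have hnode : ∀ i, node (q, t ++ w ++ [dig0]) i = node (q, t) i ++ w ++ [dig0] := fun i => by
      rw [node_append, node_append]
    refine ⟨⟨(q, t ++ w ++ [dig0]), ?_⟩, w, 0, by simpa using hnode, ?_, by simp⟩
    · rw [node_append]
      exact hw.append_zeros 1
    · intro i h1 h2 γ hγ
      rw [hnode] at hγ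
      exact hopen _ i h1 h2 γ hγ
  | true =>
    obtain ⟨l, N, hl, hfr⟩ := exists_frame_extending (d := d) p q (t ++ w)
    have hnode : ∀ i, node (l + 1, []) i =
        node (q, t) i ++ (w ++ List.replicate N dig0) ++ [i] := fun i => by
      rw [node, hfr]
      simp [node]
    refine ⟨⟨(l + 1, []), ?_⟩, w ++ List.replicate N dig0, l, by simpa using hnode, ?_, ?_⟩
    · have h1 := (hw.append_zeros N).append_zeros 1
      rw [node_append] at h1
      rw [hnode, ← List.append_assoc]
      exact h1
    · intro i h1 h2 γ hγ
      rw [hnode, ← List.append_assoc, List.append_assoc] at hγ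
      exact hopen _ i h1 h2 γ hγ
    · have := congrArg List.length (hfr dig0)
      simp only [length_frame, List.length_append, List.length_cons] at this
      refine fun _ => ⟨?_, hl⟩
      simp only [List.length_append]
      omega

/-! ### Reduction of Cantor sets to branches of the tree -/

theorem polishSpace_seq (d : ℕ∞) : PolishSpace (ℕ → Dig d) where

/-- For any choice of finer Polish topologies on the factors, there is a continuous map `f` from the
Cantor space into `[T_d]`, such that the ones of `𝒮(f(α)_0 Δ f(α)_1)` are the images of those of `α` by
an increasing map which preserves the first component for the pairing. -/
theorem exists_reduction (τ : Dig d → TopologicalSpace (ℕ → Dig d))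
    (hτ : ∀ i, IsFinerZeroDimPolish (Pi.topologicalSpace : TopologicalSpace (ℕ → Dig d)) (τ i)) :
    ∃ (f : Cantor → Dig d → ℕ → Dig d) (l : Cantor → ℕ → ℕ),
      (∀ i, @Continuous _ _ _ (τ i) fun α => f α i) ∧ (∀ α, f α ∈ body (frameTree d)) ∧
      (∀ α n, shift (symDiff (f α dig0) (f α dig1)) n = true ↔ ∃ k, α k = true ∧ n = l α k) ∧
      (∀ α k, α k = true → pr0 (l α k) = pr0 k) ∧
      ∀ α j k, α j = true → α k = true → j < k → l α j < l α k := by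
  have := polishSpace_seq d
  choose O hOo hOd hO using fun i =>
    exists_dense_open_seq (τ i) (hτ i).2.1 (hτ i).1 (boundedSeqs i)
  -- The stage `k` takes care of the dense open sets of index `(k)_1`, and `((k)_1)_k` takes each value
  -- infinitely often.
  choose next w l hnext hopen hl using fun k => exists_step (fun i => O i (pr1 k))
    (fun i => hOo i _) (fun i => hOd i _) k (pr0 k)
  have h0 : BoundedList dig0 (node ((0, []) : ℕ × List (Dig d)) dig0) := by
    intro n a ha
    simp only [node, frame_zero, List.nil_append] at ha
    obtain rfl := List.mem_singleton.1 (List.mem_of_getElem? ha)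
    exact Nat.zero_le _
  let S := {s : ℕ × List (Dig d) // BoundedList dig0 (node s dig0)}
  let st : Cantor → ℕ → S := fun α k => Nat.rec ⟨(0, []), h0⟩ (fun k s => next k (α k) s) k
  have hst : ∀ α k, st α (k + 1) = next k (α k) (st α k) := fun _ _ => rfl
  let x : Cantor → ℕ → Dig d → List (Dig d) := fun α k i => node (st α k).1 i
  have hx : ∀ α k i, x α (k + 1) i =
      x α k i ++ w k (α k) (st α k) ++ [if α k then i else dig0] := fun α k i =>
    hnext k (α k) (st α k) i
  let len : Cantor → ℕ → ℕ := fun α k => (st α k).1.1 + (st α k).1.2.length + 1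
  have hlen : ∀ α k i, (x α k i).length = len α k := fun α k i => length_node _ _
  have hlen_succ : ∀ α k, len α (k + 1) = len α k + (w k (α k) (st α k)).length + 1 := by
    intro α k
    rw [← hlen α (k + 1) dig0, hx]
    simp [hlen, add_assoc]
  have hlen_mono : ∀ α, Monotone (len α) := fun α =>
    monotone_nat_of_le_succ fun k => by rw [hlen_succ]; omega
  have hlt_len : ∀ α k, k < len α k := by
    intro α k
    induction k with
    | zero => exact Nat.succ_pos _
    | succ k ih => rw [hlen_succ]; omega
  have hll : ∀ α k, α k = true → l k (α k) (st α k) + 1 =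
      len α k + (w k (α k) (st α k)).length := by
    intro α k hk
    have := (hl k (α k) (st α k) hk).1
    simp only [len]
    omega
  have hstable : ∀ α i k m n, k ≤ m → n < len α k → (x α m i)[n]? = (x α k i)[n]? := by
    intro α i k m n hkm hn
    induction m, hkm using Nat.le_induction with
    | base => rfl
    | succ m hkm ih =>
      have h1 : n < len α m := hn.trans_le (hlen_mono α hkm)
      rw [hx, List.append_assoc, List.getElem?_append_left (by rwa [hlen]), ih]
  let f : Cantor → Dig d → ℕ → Dig d := fun α i n => (x α n i).getD n dig0
  have hf : ∀ α i k n, n < len α k → (x α k i)[n]? = some (f α i n) := by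
    intro α i k n hn
    rw [← hstable α i k (max k n) n (le_max_left _ _) hn,
      hstable α i n (max k n) n (le_max_right _ _) (hlt_len α n)]
    have : n < (x α n i).length := (hlt_len α n).trans_eq (hlen α n i).symm
    simp [f, this]
  have hinit : ∀ α i k, IsInit (x α k i) (f α i) := by
    intro α i k n a ha
    have hn : n < len α k := by
      rw [← hlen α k i]
      exact (List.getElem?_eq_some_iff.1 ha).1
    have h1 : some a = some (f α i n) := ha.symm.trans (hf α i k n hn)
    simpa using h1.symm
  have hfK : ∀ α i, f α i ∈ boundedSeqs i := fun α i n =>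
    (st α n).2.node i n _ (hf α i n n (hlt_len α n))
  have hcont : ∀ i, Continuous fun α => (⟨f α i, hfK α i⟩ : boundedSeqs i) := by
    intro i
    let : TopologicalSpace S := ⊥
    have : DiscreteTopology S := ⟨rfl⟩
    have hstc : ∀ k, Continuous fun α => st α k := by
      intro k
      induction k with
      | zero => exact continuous_const
      | succ k ih =>
        have h1 : Continuous fun α : Cantor => (α k, st α k) := (continuous_apply k).prodMk ih
        exact (continuous_of_discreteTopology (f := fun p : Bool × S => next k p.1 p.2)).comp h1
    refine Continuous.subtype_mk (continuous_pi fun n => ?_) _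
    exact (continuous_of_discreteTopology
      (f := fun s : S => (node s.1 i).getD n dig0)).comp (hstc n)
  have hdiff : ∀ α k n, n < len α k → (f α dig0 n ≠ f α dig1 n ↔
      n = 0 ∨ ∃ j < k, α j = true ∧ n = l j (α j) (st α j) + 1) := by
    intro α k
    induction k with
    | zero =>
      intro n hn
      obtain rfl : n = 0 := by
        have : len α 0 = 1 := rfl
        omega
      have e0 := hf α dig0 0 0 hn
      have e1 := hf α dig1 0 0 hn
      have hx0 : ∀ i, x α 0 i = [i] := fun i => by
        change node ((0, []) : ℕ × List (Dig d)) i = [i]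
        simp [node, frame_zero]
      simp only [hx0, List.getElem?_cons_zero, Option.some.injEq] at e0 e1
      rw [← e0, ← e1]
      simp [dig0, dig1]
    | succ k ih =>
      intro n hn
      rcases Nat.lt_or_ge n (len α k) with h1 | h1
      · rw [ih n h1]
        refine or_congr Iff.rfl ⟨fun ⟨j, hj, h⟩ => ⟨j, hj.trans (lt_add_one k), h⟩, ?_⟩
        rintro ⟨j, hj, hαj, rfl⟩
        refine ⟨j, lt_of_le_of_ne (Nat.lt_succ_iff.1 hj) ?_, hαj, rfl⟩
        rintro rfl
        have := hll α j hαj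
        omega
      · have hn0 : n ≠ 0 := by
          have := hlt_len α k
          omega
        have hnj : ∀ j < k, α j = true → n ≠ l j (α j) (st α j) + 1 := by
          intro j hj hαj h
          have h2 := hll α j hαj
          have h3 := hlen_succ α j
          have h4 := hlen_mono α (Nat.succ_le_of_lt hj)
          simp only [Nat.succ_eq_add_one] at h4
          omega
        have hval : ∀ i, some (f α i n) =
            (w k (α k) (st α k) ++ [if α k then i else dig0])[n - len α k]? := by
          intro i
          rw [← hf α i (k + 1) n hn, hx, List.append_assoc,
            List.getElem?_append_right (by rwa [hlen]), hlen]
        have e0 := hval dig0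
        have e1 := hval dig1
        have hs := hlen_succ α k
        rcases Nat.lt_or_ge (n - len α k) (w k (α k) (st α k)).length with h2 | h2
        · rw [List.getElem?_append_left h2] at e0 e1
          have heq : f α dig0 n = f α dig1 n := Option.some.inj (e0.trans e1.symm)
          simp only [heq, ne_eq, not_true_eq_false, false_iff, not_or, not_exists, not_and]
          refine ⟨hn0, fun j hj hαj => ?_⟩
          rcases Nat.lt_succ_iff_lt_or_eq.1 hj with hj | rfl
          · exact hnj j hj hαj
          · have := hll α j hαj
            omega
        · have h3 : n - len α k = (w k (α k) (st α k)).length := by omega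
          rw [h3, List.getElem?_append_right le_rfl] at e0 e1
          simp only [Nat.sub_self, List.getElem?_cons_zero, Option.some.injEq] at e0 e1
          rw [e0, e1]
          cases hαk : α k with
          | true =>
            have := hll α k hαk
            refine iff_of_true (by simp [dig0, dig1]) (Or.inr ⟨k, lt_add_one k, hαk, ?_⟩)
            omega
          | false =>
            refine iff_of_false (by simp) ?_
            rintro (h | ⟨j, hj, hαj, h⟩)
            · exact hn0 h
            · rcases Nat.lt_succ_iff_lt_or_eq.1 hj with hj | rfl
              · exact hnj j hj hαj h
              · simp [hαk] at hαj
  refine ⟨f, fun α k => l k (α k) (st α k), fun i => ?_, fun α n => ?_, fun α n => ?_,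
    fun α k hk => (hl k (α k) (st α k) hk).2, fun α j k hj hk hjk => ?_⟩
  · refine hO i _ (hcont i) fun α k => ?_
    have h1 : (i : ℕ) ≤ pr i k := le_pr_left _ _
    have h2 := hopen (pr i k) (α (pr i k)) (st α (pr i k)) i h1 (by
      have := hlt_len α (pr i k)
      simp only [len] at this
      omega) ⟨f α i, hfK α i⟩ (hinit α i (pr i k + 1))
    simpa using h2
  · have hmem : (List.range (len α n)).map (fun j i => f α i j) ∈ frameTree d := by
      refine Or.inr ⟨(st α n).1.1, (st α n).1.2, fun i => ?_, fun m hm => ?_⟩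
      · change _ = x α n i
        refine List.ext_getElem? fun m => ?_
        rcases Nat.lt_or_ge m (len α n) with hm | hm
        · rw [hf α i n m hm]
          simp [List.getElem?_range hm]
        · rw [List.getElem?_eq_none (by simpa using hm),
            List.getElem?_eq_none (by rwa [hlen])]
      · have := hfK α dig0 m
        simpa [dig0] using this
    have hdown : ∀ m k, (List.range (m + k)).map (fun j i => f α i j) ∈ frameTree d →
        (List.range m).map (fun j i => f α i j) ∈ frameTree d := by
      intro m k
      induction k with
      | zero => exact id
      | succ k ih =>
        intro h
        rw [← add_assoc, List.range_succ, List.map_append] at h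
        exact ih (frameTree_mem_tree d h)
    refine hdown n (len α n - n) ?_
    rwa [Nat.add_sub_cancel' (hlt_len α n).le]
  · have h1 : shift (symDiff (f α dig0) (f α dig1)) n = true ↔
        f α dig0 (n + 1) ≠ f α dig1 (n + 1) := by
      simp [shift, symDiff]
    rw [h1]
    constructor
    · intro h
      rcases (hdiff α (n + 1) (n + 1) (hlt_len α _)).1 h with h | ⟨j, -, hj, h⟩
      · omega
      · exact ⟨j, hj, by simpa using h⟩
    · rintro ⟨k, hk, rfl⟩
      refine (hdiff α (k + 1) _ ?_).2 (Or.inr ⟨k, lt_add_one k, hk, rfl⟩)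
      have h2 := hll α k hk
      have h3 := hlen_succ α k
      omega
  · have h2 := hll α j hj
    have h3 := hlen_succ α j
    have h4 := hll α k hk
    have h5 := hlen_mono α (Nat.succ_le_of_lt hjk)
    beta_reduce at h2
    simp only [Nat.succ_eq_add_one] at h5
    change l j (α j) (st α j) < l k (α k) (st α k)
    omega

end

/-! ### Invariance of `C_ξ` and `C_ξ^ε` -/

section Transfer

variable {θ : Ordinal.{0} → ℕ → Ordinal.{0}} {ξ : Ordinal.{0}} {α β : Cantor} {l : ℕ → ℕ}

/-- Suppose that the ones of `β` are the images of those of `α` by a map `l` preserving the first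
component for the pairing. Then `ρ_0(α) = ρ_0(β)`, since a row has a one in `α` exactly when it has one
in `β`; so only `ρ_0^0 = Id` can distinguish `α` from `β`. -/
theorem rho_eq_or_of_transfer (hθ : IsLimitChoice θ) (hξ : ξ < ω₁)
    (h1 : ∀ n, β n = true ↔ ∃ k, α k = true ∧ n = l k)
    (h2 : ∀ k, α k = true → pr0 (l k) = pr0 k) :
    rho θ (ξ - 1) = id ∨ rho θ (ξ - 1) α = rho θ (ξ - 1) β := by
  rcases eq_or_ne (ξ - 1) 0 with h | h
  · left
    rw [h, rho_zero]
  · right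
    refine rho_congr hθ (Order.one_le_iff_ne_zero.2 h) ((Ordinal.sub_le_self ξ 1).trans_lt hξ) ?_
    have key : ∀ m, rhoZero α m = false ↔ rhoZero β m = false := by
      intro m
      rw [rhoZero_eq_false, rhoZero_eq_false]
      constructor
      · rintro ⟨n, hn⟩
        refine ⟨pr1 (l (pr m n)), (h1 _).2 ⟨_, hn, ?_⟩⟩
        have h3 : m = pr0 (l (pr m n)) := by rw [h2 _ hn, pr0_pr]
        calc pr m (pr1 (l (pr m n))) = pr (pr0 (l (pr m n))) (pr1 (l (pr m n))) := by rw [← h3]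
          _ = l (pr m n) := pr_pr0_pr1 _
      · rintro ⟨n, hn⟩
        obtain ⟨k, hk, hk'⟩ := (h1 _).1 hn
        refine ⟨pr1 k, ?_⟩
        have h3 : m = pr0 k := by rw [← h2 _ hk, ← hk', pr0_pr]
        rwa [h3, pr_pr0_pr1]
    funext m
    have := key m
    cases ha : rhoZero α m <;> cases hb : rhoZero β m <;> simp [ha, hb] at this ⊢

theorem mem_CSet_iff_of_transfer (hθ : IsLimitChoice θ) (hξ : ξ < ω₁)
    (h1 : ∀ n, β n = true ↔ ∃ k, α k = true ∧ n = l k)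
    (h2 : ∀ k, α k = true → pr0 (l k) = pr0 k) : α ∈ CSet θ ξ ↔ β ∈ CSet θ ξ := by
  rw [mem_CSet, mem_CSet]
  rcases rho_eq_or_of_transfer hθ hξ h1 h2 with h | h
  · simp only [h, id_eq, h1]
    exact ⟨fun ⟨k, hk⟩ => ⟨_, k, hk, rfl⟩, fun ⟨_, k, hk, _⟩ => ⟨k, hk⟩⟩
  · rw [h]

/-- The order of the ones matters only for `ξ = 1`, where the first one of `α` has to be sent to the
first one of `β`. -/
theorem mem_CSetPar_of_transfer (hθ : IsLimitChoice θ) (hξ : ξ < ω₁)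
    (h1 : ∀ n, β n = true ↔ ∃ k, α k = true ∧ n = l k)
    (h2 : ∀ k, α k = true → pr0 (l k) = pr0 k)
    (h3 : ∀ j k, α j = true → α k = true → j < k → l j < l k) {ε : Fin 2}
    (hα : α ∈ CSetPar θ ξ ε) : β ∈ CSetPar θ ξ ε := by
  obtain ⟨m, hm, hmin, hpar⟩ := hα
  rcases rho_eq_or_of_transfer hθ hξ h1 h2 with h | h
  · rw [h] at hm hmin
    refine ⟨l m, ?_, fun n hn => ?_, by rw [h2 m hm, hpar]⟩
    · rw [h]
      exact (h1 _).2 ⟨m, hm, rfl⟩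
    · rw [h, id_eq, ← Bool.not_eq_true, h1]
      rintro ⟨k, hk, rfl⟩
      rcases lt_trichotomy k m with hkm | rfl | hkm
      · have := hmin k hkm
        simp [hk] at this
      · exact lt_irrefl _ hn
      · exact lt_asymm hn (h3 m k hm hk hkm)
  · rw [h] at hm hmin
    exact ⟨m, hm, hmin, hpar⟩

end Transfer

/-! ### The sets of branches -/

theorem SigmaZero.preimage_pi {d : ℕ∞} {ξ : Ordinal.{0}}
    {τ : Dig d → TopologicalSpace (ℕ → Dig d)}
    {f : Cantor → Dig d → ℕ → Dig d}
    (hf : ∀ i, @Continuous _ _ _ (τ i) fun α => f α i) {P : Set (Dig d → ℕ → Dig d)}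
    (hP : @SigmaZero _ (@Pi.topologicalSpace _ _ τ) ξ P) : SigmaZero ξ (f ⁻¹' P) :=
  @SigmaZero.preimage _ (@Pi.topologicalSpace _ _ τ) ξ P _ _ f
    (@continuous_pi _ _ _ _ τ f hf) hP

section

variable {d : ℕ∞} [hd : Fact (2 ≤ d)] {θ : Ordinal.{0} → ℕ → Ordinal.{0}} {ξ : Ordinal.{0}}

theorem isSigmaZeroIn_SSet {C : Set Cantor} (hC : SigmaZero ξ C) :
    IsSigmaZeroIn ξ (body (frameTree d)) (SSet d C) := by
  refine ⟨fun α hα => hα.1, ?_⟩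
  have hcont : Continuous fun α : body (frameTree d) =>
      shift (symDiff (α.1 dig0) (α.1 dig1)) := by
    refine continuous_pi fun n => ?_
    have h1 : Continuous fun α : body (frameTree d) =>
        (α.1 dig0 (n + 1), α.1 dig1 (n + 1)) := by
      have h2 : ∀ i : Dig d, Continuous fun α : body (frameTree d) => α.1 i (n + 1) := fun i =>
        (continuous_apply (n + 1)).comp ((continuous_apply i).comp continuous_subtype_val)
      exact (h2 dig0).prodMk (h2 dig1)
    exact (continuous_of_discreteTopology
      (f := fun p : Dig d × Dig d => symDiff (fun _ : ℕ => p.1) (fun _ => p.2) 0)).comp h1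
  have h2 : (Subtype.val : body (frameTree d) → _) ⁻¹' SSet d C =
      (fun α : body (frameTree d) => shift (symDiff (α.1 dig0) (α.1 dig1))) ⁻¹' C :=
    Set.ext fun α => and_iff_right α.2
  rw [h2]
  exact hC.preimage hcont

theorem not_potSeparable_pi (hθ : IsLimitChoice θ) (h1 : 1 ≤ ξ) (hξ : ξ < ω₁) :
    ¬ PotSeparable (piClass ξ) (SSet d (CSet θ ξ))
      (body (frameTree d) \ SSet d (CSet θ ξ)) := by
  rintro ⟨P, ⟨-, τ, hτ, hP⟩, hsub, hdis⟩
  obtain ⟨f, l, hf, hbody, hones, hpr, -⟩ := exists_reduction τ hτ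
  refine not_piZero_CSet hθ h1 hξ ?_
  have hpre : f ⁻¹' P = CSet θ ξ := by
    ext α
    have hiff := mem_CSet_iff_of_transfer hθ hξ (hones α) (hpr α)
    constructor
    · intro hα
      by_contra hC
      exact Set.disjoint_left.1 hdis hα ⟨hbody α, fun h => hC (hiff.2 h.2)⟩
    · exact fun hα => hsub ⟨hbody α, hiff.1 hα⟩
  rw [← hpre]
  exact SigmaZero.preimage_pi hf hP

theorem not_potSeparable_delta (hθ : IsLimitChoice θ) (h1 : 1 ≤ ξ) (hξ : ξ < ω₁) :
    ¬ PotSeparable (deltaClass ξ) (SSet d (CSetPar θ ξ 0)) (SSet d (CSetPar θ ξ 1)) := by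
  rintro ⟨P, ⟨-, τ, hτ, hP⟩, hsub, hdis⟩
  obtain ⟨f, l, hf, hbody, hones, hpr, hmono⟩ := exists_reduction τ hτ
  have htransfer : ∀ (ε : Fin 2) (α : Cantor), α ∈ CSetPar θ ξ ε → f α ∈ SSet d (CSetPar θ ξ ε) :=
    fun ε α hα =>
      ⟨hbody α, mem_CSetPar_of_transfer hθ hξ (hones α) (hpr α) (hmono α) hα⟩
  have hD : DeltaZero ξ (f ⁻¹' P) :=
    ⟨SigmaZero.preimage_pi hf hP.1, SigmaZero.preimage_pi hf hP.2⟩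
  refine not_deltaZero_separates hθ h1 hξ hD (fun α hα => hsub (htransfer 0 α hα)) ?_
  rw [Set.disjoint_left]
  exact fun α hα hα' => Set.disjoint_left.1 hdis hα (htransfer 1 α hα')

theorem disjoint_SSet {C C' : Set Cantor} (h : Disjoint C C') :
    Disjoint (SSet d C) (SSet d C') := by
  rw [Set.disjoint_left]
  exact fun α hα hα' => Set.disjoint_left.1 h hα.2 hα'.2

end

end PotWadge

theorem theorem3p1 (d : ℕ∞) [Fact (2 ≤ d)] :
    PotWadge.IsTreeWithDeltaSuitableLevels (PotWadge.frameTree d) ∧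
    ∀ θ : Ordinal.{0} → ℕ → Ordinal.{0}, PotWadge.IsLimitChoice θ →
    ∀ ξ : Ordinal.{0}, 1 ≤ ξ → ξ < Ordinal.omega 1 →
      (PotWadge.IsSigmaZeroIn ξ (PotWadge.body (PotWadge.frameTree d))
          (PotWadge.SSet d (PotWadge.CSet θ ξ)) ∧
        ¬ PotWadge.PotSeparable (PotWadge.piClass ξ)
          (PotWadge.SSet d (PotWadge.CSet θ ξ))
          (PotWadge.body (PotWadge.frameTree d) \ PotWadge.SSet d (PotWadge.CSet θ ξ))) ∧
      (PotWadge.IsSigmaZeroIn ξ (PotWadge.body (PotWadge.frameTree d))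
          (PotWadge.SSet d (PotWadge.CSetPar θ ξ 0)) ∧
        PotWadge.IsSigmaZeroIn ξ (PotWadge.body (PotWadge.frameTree d))
          (PotWadge.SSet d (PotWadge.CSetPar θ ξ 1)) ∧
        Disjoint (PotWadge.SSet d (PotWadge.CSetPar θ ξ 0))
          (PotWadge.SSet d (PotWadge.CSetPar θ ξ 1)) ∧
        ¬ PotWadge.PotSeparable (PotWadge.deltaClass ξ)
          (PotWadge.SSet d (PotWadge.CSetPar θ ξ 0))
          (PotWadge.SSet d (PotWadge.CSetPar θ ξ 1))) :=
  ⟨PotWadge.isTreeWithDeltaSuitableLevels_frameTree d, fun _ hθ _ h1 hξ =>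
    ⟨⟨PotWadge.isSigmaZeroIn_SSet (PotWadge.sigmaZero_CSet hθ h1 hξ),
      PotWadge.not_potSeparable_pi hθ h1 hξ⟩,
    PotWadge.isSigmaZeroIn_SSet (PotWadge.sigmaZero_CSetPar hθ h1 hξ 0),
    PotWadge.isSigmaZeroIn_SSet (PotWadge.sigmaZero_CSetPar hθ h1 hξ 1),
    PotWadge.disjoint_SSet PotWadge.disjoint_CSetPar,
    PotWadge.not_potSeparable_delta hθ h1 hξ⟩⟩
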